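/- Let $G=(V,E)$ be a finite directed graph without loops or multiple edges, and assume that $G$ is strongly connected. A nonempty subset $W\subseteq V$ is called strongly connected if the subgraph of $G$ induced on $W$ is strongly connected (a single vertex is strongly connected). *Trees and matrices.* An oriented spanning tree of $G$ is a subgraph containing all vertices, without oriented cycles, in which one vertex (the root) has outdegree $0$ and every other vertex has outdegree $1$. Let $x_e$ ($e\in E$) and $y_v$ ($v\in V$) be indeterminates. The Schrödinger operator of $G$ is the $V\times V$ matrix $L=Q+Y$, where for $v\neq w$ the entry $Q_{vw}$ is $x_e$ if $e$ is an edge from $v$ to $w$ and $0$ if there is no such edge, $Q_{vv}=-\sum_{e:\,s(e)=v}x_e$, and $Y$ is diagonal with $Y_{vv}=y_v$. For $W\subseteq V$, $L_W$ is the submatrix of $L$ with rows and columns indexed by $W$. The tree graph $\mathcal TG$ has the oriented spanning trees of $G$ as vertices; for each tree $\mathbf a$ with root $r$ and each edge $e$ of $G$ with source $r$ it has an edge of weight $x_e$ from $\mathbf a$ to the tree $\mathbf b$ obtained from $\mathbf a$ by adding $e$ and deleting the edge of $\mathbf a$ going out of the target of $e$. The lifted Schrödinger operator is $\mathcal L=\mathcal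 Q+\mathcal Y$, indexed by the oriented spanning trees, where for $\mathbf a\ne\mathbf b$ the entry $\mathcal Q_{\mathbf a\mathbf b}$ is the weight of the edge $\mathbf a\to\mathbf b$ of $\mathcal TG$ ($0$ if there is none), $\mathcal Q_{\mathbf a\mathbf a}=-\sum_{\mathbf b\neq\mathbf a}\mathcal Q_{\mathbf a\mathbf b}$, and $\mathcal Y$ is diagonal with $\mathcal Y_{\mathbf a\mathbf a}=y_{\mathrm{root}(\mathbf a)}$. *Exploration algorithm.* Fix a total order on $V$. Given an oriented spanning tree $\mathbf a$ with root $v$, start with $A=\{v\}$, $F=\{e\in E: s(e)\neq v\}$ and $\mathbf L$ the list of the edges of $G$ with target $v$, ordered by increasing source. While $\mathbf L$ is not empty, let $e$ be its first edge and $w$ the source of $e$. If $e$ belongs to $\mathbf a$: add $w$ to $A$, delete all edges with source $w$ from $\mathbf L$, and append at the end of $\mathbf L$ all edges in $F$ with target $w$, by increasing source. Otherwise: delete from $\mathbf L$ and from $F$ all edges with source or target $w$. This terminates; $\phi(\mathbf a)$ is the terminal value of $A$, and $\psi(\mathbf a)$ is the strongly connected component of $v$ in the subgraph of $G$ induced on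 $\phi(\mathbf a)$. For a strongly connected $W\subseteq V$ and $w\in W$, let $m(W,w)$ be the number of oriented spanning trees $\mathbf a$ of $G$ with root $w$ and $\psi(\mathbf a)=W$. *Claim.* Let $W\subseteq V$ be strongly connected. Then $m(W,w)$ depends neither on the base point $w\in W$ nor on the total order on $V$. Moreover $\det(L_W)$ is a prime element of the polynomial ring $\mathbb C[x_e,\,y_v : e\in E,\ v\in V]$, and the common value $m(W)$ of the numbers $m(W,w)$ is the multiplicity of the prime $\det(L_W)$ in $\det(\mathcal L)$, that is, the largest $k$ such that $\det(L_W)^k$ divides $\det(\mathcal L)$ (it may be $0$). -/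

import Mathlib

namespace TreeGraph

variable {V : Type*}

/-- An edge of `G`, as the pair (source, target). A digraph is given by its adjacency relation, so
there is at most one edge with given source and target. -/
abbrev Edge (G : Digraph V) : Type _ := {e : V × V // G.Adj e.1 e.2}

/-- One step along an edge of the subgraph of `G` induced on the vertex set `X`. -/
def StepIn (G : Digraph V) (X : Finset V) (u v : V) : Prop := u ∈ X ∧ v ∈ X ∧ G.Adj u v

/-- There is an oriented path (possibly of length zero) from `u` to `v` in the subgraph of `G`
induced on `X`. -/
def ReachIn (G : Digraph V) (X : Finset V) (u v : V) : Prop :=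
  Relation.ReflTransGen (StepIn G X) u v

/-- A vertex set `W` is strongly connected if it is nonempty and the subgraph of `G` induced on `W`
has an oriented path from any vertex of `W` to any other one. -/
def StronglyConnected (G : Digraph V) (W : Finset V) : Prop :=
  W.Nonempty ∧ ∀ u ∈ W, ∀ v ∈ W, ReachIn G W u v

/-- An oriented spanning tree of `G`: a subgraph of `G` on all the vertices, without oriented
cycles, whose root has outdegree `0` and whose other vertices have outdegree `1`. -/
@[ext]
structure SpanningTree (G : Digraph V) where
  root : V
  edges : Finset (V × V)
  subgraph : ∀ e ∈ edges, G.Adj e.1 e.2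
  root_out : ∀ w, (root, w) ∉ edges
  other_out : ∀ v, v ≠ root → ∃! w, (v, w) ∈ edges
  acyclic : ∀ v, ¬ Relation.TransGen (fun u w => (u, w) ∈ edges) v v

instance (G : Digraph V) [DecidableEq V] : DecidableEq (SpanningTree G) := fun a b =>
  decidable_of_iff (a.root = b.root ∧ a.edges = b.edges)
    ⟨fun h => SpanningTree.ext h.1 h.2, fun h => h ▸ ⟨rfl, rfl⟩⟩

noncomputable instance (G : Digraph V) [Fintype V] [DecidableEq V] : Fintype (SpanningTree G) :=
  Fintype.ofInjective (fun a : SpanningTree G => (a.root, a.edges))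
    (fun _ _ h => SpanningTree.ext (congrArg Prod.fst h) (congrArg Prod.snd h))

section Schrodinger

/-- Polynomials over `ℂ` in one variable `x e` for each edge `e` of `G` and one variable `y v` for
each vertex `v`. -/
abbrev Poly (G : Digraph V) : Type _ := MvPolynomial (Edge G ⊕ V) ℂ

noncomputable def x {G : Digraph V} (e : Edge G) : Poly G := MvPolynomial.X (Sum.inl e)

noncomputable def y (G : Digraph V) (v : V) : Poly G := MvPolynomial.X (Sum.inr v)

variable [Fintype V] [DecidableEq V] (G : Digraph V) [DecidableRel G.Adj]

/-- The edge-weighted Laplacian `Q` of `G`. -/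
noncomputable def laplacian : Matrix V V (Poly G) := fun v w =>
  if v = w then - ∑ e : Edge G, (if e.1.1 = v then x e else 0)
  else if h : G.Adj v w then x ⟨(v, w), h⟩ else 0

/-- The Schrödinger operator `L = Q + Y` of `G`. -/
noncomputable def schrodinger : Matrix V V (Poly G) :=
  laplacian G + Matrix.diagonal (y G)

/-- The submatrix `L_W` of `L` with rows and columns indexed by `W`. -/
noncomputable def schrodingerOn (W : Finset V) : Matrix W W (Poly G) :=
  (schrodinger G).submatrix Subtype.val Subtype.val

variable {G}

/-- The tree graph has an edge from `a` to `b`, lying above the edge `e` of `G`: the source of `e` is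
the root of `a`, and `b` is obtained from `a` by adding `e` and then deleting the edge of `a` that
goes out of the target of `e`. -/
def TreeEdge (e : Edge G) (a b : SpanningTree G) : Prop :=
  e.1.1 = a.root ∧ b.edges = (insert e.1 a.edges).filter (fun f => f.1 ≠ e.1.2)

instance (e : Edge G) (a b : SpanningTree G) : Decidable (TreeEdge e a b) := by
  unfold TreeEdge; infer_instance

variable (G)

/-- The weighted adjacency matrix of the tree graph: an edge of the tree graph lying above the edge
`e` of `G` has weight `x e` (there is at most one such `e` for given `a` and `b`). -/
noncomputable def treeWeight (a b : SpanningTree G) : Poly G :=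
  ∑ e : Edge G, if TreeEdge e a b then x e else 0

/-- The weighted Laplacian `𝒬` of the tree graph. -/
noncomputable def treeLaplacian : Matrix (SpanningTree G) (SpanningTree G) (Poly G) := fun a b =>
  if a = b then - ∑ c ∈ Finset.univ.erase a, treeWeight G a c else treeWeight G a b

/-- The lifted Schrödinger operator `ℒ = 𝒬 + 𝒴`, where `𝒴` has the diagonal entry `y v` at a tree
rooted at `v`. -/
noncomputable def treeSchrodinger : Matrix (SpanningTree G) (SpanningTree G) (Poly G) :=
  treeLaplacian G + Matrix.diagonal (fun a => y G a.root)

end Schrodinger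

section Exploration

/-- The running variables of the exploration algorithm: the set `A` of explored vertices, the
first-in-first-out list `L` of edges, and the set `F` of edges. -/
structure ExploreState (V : Type*) where
  A : Finset V
  L : List (V × V)
  F : Finset (V × V)

variable [Fintype V] [DecidableEq V]

/-- The edges in `F` with target `w`, ordered by increasing source. -/
def edgesInto (o : LinearOrder V) (F : Finset (V × V)) (w : V) : List (V × V) :=
  ((Finset.univ.filter (fun u => (u, w) ∈ F)).sort (fun u v => o.le u v)).map (fun u => (u, w))

variable {G : Digraph V}

/-- Initialization of the exploration algorithm on the spanning tree `a`. -/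
def exploreInit [DecidableRel G.Adj] (o : LinearOrder V) (a : SpanningTree G) : ExploreState V where
  A := {a.root}
  L := edgesInto o (Finset.univ.filter (fun e => G.Adj e.1 e.2)) a.root
  F := Finset.univ.filter (fun e => G.Adj e.1 e.2 ∧ e.1 ≠ a.root)

/-- One iteration of the exploration algorithm; nothing happens once the list is empty. -/
def exploreStep (o : LinearOrder V) (a : SpanningTree G) (s : ExploreState V) : ExploreState V :=
  match s.L with
  | [] => s
  | e :: _ =>
    if e ∈ a.edges then
      { A := insert e.1 s.A
        L := s.L.filter (fun f => f.1 ≠ e.1) ++ edgesInto o s.F e.1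
        F := s.F }
    else
      { A := s.A
        L := s.L.filter (fun f => f.1 ≠ e.1 ∧ f.2 ≠ e.1)
        F := s.F.filter (fun f => f.1 ≠ e.1 ∧ f.2 ≠ e.1) }

/-- The state in which the algorithm terminates. That `2 * |V|` iterations are enough is proved in
`exploreFinal_list` below; further iterations would not change the state. -/
def exploreFinal [DecidableRel G.Adj] (o : LinearOrder V) (a : SpanningTree G) : ExploreState V :=
  (exploreStep o a)^[2 * Fintype.card V] (exploreInit o a)

/-- The set `φ(a)`: the terminal value of the set of explored vertices. -/
def phi [DecidableRel G.Adj] (o : LinearOrder V) (a : SpanningTree G) : Finset V :=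
  (exploreFinal o a).A

open Classical in
/-- The set `ψ(a)`: the strongly connected component of the root of `a` in the subgraph of `G`
induced on `φ(a)`. -/
noncomputable def psi [DecidableRel G.Adj] (o : LinearOrder V) (a : SpanningTree G) : Finset V :=
  (phi o a).filter (fun u => ReachIn G (phi o a) a.root u ∧ ReachIn G (phi o a) u a.root)

/-- The multiplicity `m(W, w)` of `W` at `w`: the number of oriented spanning trees `a` of `G` rooted
at `w` with `ψ(a) = W`. -/
noncomputable def mult (G : Digraph V) [DecidableRel G.Adj] (o : LinearOrder V)
    (W : Finset V) (w : V) : ℕ :=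
  (Finset.univ.filter (fun a : SpanningTree G => a.root = w ∧ psi o a = W)).card

/-! The exploration algorithm terminates after at most `2 * |V|` iterations. -/

theorem mem_edgesInto {o : LinearOrder V} {F : Finset (V × V)} {w : V} {f : V × V} :
    f ∈ edgesInto o F w ↔ f ∈ F ∧ f.2 = w := by
  obtain ⟨u, v⟩ := f
  simp only [edgesInto, List.mem_map, Finset.mem_sort, Finset.mem_filter, Finset.mem_univ,
    true_and, Prod.mk.injEq]
  constructor
  · rintro ⟨_, h, rfl, rfl⟩
    exact ⟨h, rfl⟩
  · rintro ⟨h, rfl⟩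
    exact ⟨u, h, rfl, rfl⟩

theorem SpanningTree.out_unique (a : SpanningTree G) {u v w : V} (hv : (u, v) ∈ a.edges)
    (hw : (u, w) ∈ a.edges) : v = w := by
  have hu : u ≠ a.root := by
    rintro rfl
    exact a.root_out _ hv
  exact (a.other_out u hu).unique hv hw

/-- Loop invariants: targets of listed edges are explored, explored vertices have explored parents,
and sources of listed tree edges are unexplored. -/
structure ExploreInv (a : SpanningTree G) (s : ExploreState V) : Prop where
  target_mem : ∀ f ∈ s.L, f.2 ∈ s.A
  parent_mem : ∀ f ∈ a.edges, f.1 ∈ s.A → f.2 ∈ s.A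
  source_notMem : ∀ f ∈ s.L, f ∈ a.edges → f.1 ∉ s.A

theorem exploreInv_init [DecidableRel G.Adj] (o : LinearOrder V) (a : SpanningTree G) :
    ExploreInv a (exploreInit o a) where
  target_mem f hf := by
    simp only [exploreInit, mem_edgesInto] at hf ⊢
    simp [hf.2]
  parent_mem f hf h := by
    simp only [exploreInit, Finset.mem_singleton] at h
    obtain ⟨u, v⟩ := f
    obtain rfl : u = a.root := h
    exact absurd hf (a.root_out v)
  source_notMem f _ hfa h := by
    simp only [exploreInit, Finset.mem_singleton] at h
    obtain ⟨u, v⟩ := f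
    obtain rfl : u = a.root := h
    exact a.root_out v hfa

/-- A quantity that decreases in each iteration: the number of unexplored vertices plus the number
of sources of edges that are in the list or in `F`. -/
def exploreMeasure (s : ExploreState V) : ℕ :=
  s.Aᶜ.card + ((s.L.toFinset ∪ s.F).image Prod.fst).card

theorem exploreStep_spec (o : LinearOrder V) (a : SpanningTree G) (s : ExploreState V)
    (hs : ExploreInv a s) (hL : s.L ≠ []) :
    ExploreInv a (exploreStep o a s) ∧ exploreMeasure (exploreStep o a s) < exploreMeasure s := by
  obtain ⟨A, L, F⟩ := s
  obtain ⟨h1, h2, h3⟩ := hs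
  cases L with
  | nil => exact absurd rfl hL
  | cons e l =>
    simp only at h1 h2 h3
    have he : e ∈ e :: l := List.mem_cons_self
    by_cases hea : e ∈ a.edges
    · have heA := h3 e he hea
      simp only [exploreStep, hea, if_true]
      refine ⟨⟨?_, ?_, ?_⟩, ?_⟩
      · intro f hf
        simp only [List.mem_append, mem_edgesInto] at hf
        rcases hf with hf | hf
        · exact Finset.mem_insert_of_mem (h1 f (List.mem_of_mem_filter hf))
        · simp [hf.2]
      · intro f hf hfA
        simp only [Finset.mem_insert] at hfA ⊢
        rcases hfA with hfA | hfA
        · right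
          have : f.2 = e.2 := a.out_unique (u := f.1) hf (by rw [hfA]; exact hea)
          rw [this]
          exact h1 e he
        · exact Or.inr (h2 f hf hfA)
      · intro f hf hfa
        simp only [List.mem_append, mem_edgesInto] at hf
        simp only [Finset.mem_insert, not_or]
        rcases hf with hf | hf
        · exact ⟨by simpa using List.of_mem_filter hf, h3 f (List.mem_of_mem_filter hf) hfa⟩
        · refine ⟨fun h => ?_, fun h => heA (hf.2 ▸ h2 f hfa h)⟩
          exact a.acyclic f.1 (Relation.TransGen.single (by
            have : f = (f.1, f.1) := Prod.ext rfl (hf.2.trans h.symm)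
            rw [← this]; exact hfa))
      · refine add_lt_add_of_lt_of_le (Finset.card_lt_card ?_) (Finset.card_le_card ?_)
        · refine ⟨fun v hv => ?_, fun h => ?_⟩
          · simp only [Finset.mem_compl, Finset.mem_insert, not_or] at hv ⊢
            exact hv.2
          · have := h (Finset.mem_compl.2 heA)
            simp at this
        · refine Finset.image_subset_image fun f hf => ?_
          simp only [Finset.mem_union, List.mem_toFinset, List.mem_append, mem_edgesInto] at hf ⊢
          rcases hf with (hf | hf) | hf
          · exact Or.inl (List.mem_of_mem_filter hf)
          · exact Or.inr hf.1
          · exact Or.inr hf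
    · simp only [exploreStep, hea, if_false]
      refine ⟨⟨?_, h2, ?_⟩, ?_⟩
      · intro f hf
        exact h1 f (List.mem_filter.1 hf).1
      · intro f hf
        exact h3 f (List.mem_filter.1 hf).1
      · refine add_lt_add_of_le_of_lt le_rfl (Finset.card_lt_card ⟨?_, fun h => ?_⟩)
        · refine Finset.image_subset_image fun f hf => ?_
          simp only [Finset.mem_union, List.mem_toFinset] at hf ⊢
          rcases hf with hf | hf
          · exact Or.inl (List.mem_of_mem_filter hf)
          · exact Or.inr (Finset.mem_of_mem_filter f hf)
        · have := h (Finset.mem_image_of_mem Prod.fst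
            (Finset.mem_union_left F (List.mem_toFinset.2 he)))
          simp only [Finset.mem_image, Finset.mem_union, List.mem_toFinset, List.mem_filter,
            Finset.mem_filter, decide_eq_true_eq] at this
          obtain ⟨f, hf, hfe⟩ := this
          rcases hf with hf | hf
          · exact hf.2.1 hfe
          · exact hf.2.1 hfe

theorem exploreFinal_list [DecidableRel G.Adj] (o : LinearOrder V) (a : SpanningTree G) :
    (exploreFinal o a).L = [] := by
  have key : ∀ (n : ℕ) (s : ExploreState V), ExploreInv a s → exploreMeasure s ≤ n →
      ((exploreStep o a)^[n] s).L = [] := by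
    intro n
    induction n with
    | zero =>
      intro s hs hn
      by_contra hL
      have := (exploreStep_spec o a s hs hL).2
      omega
    | succ n ih =>
      intro s hs hn
      rw [Function.iterate_succ_apply]
      by_cases hL : s.L = []
      · have hstep : exploreStep o a s = s := by
          unfold exploreStep
          rw [hL]
        rw [hstep, Function.iterate_fixed hstep]
        exact hL
      · obtain ⟨h, hlt⟩ := exploreStep_spec o a s hs hL
        exact ih _ h (by omega)
  refine key _ _ (exploreInv_init o a) ?_
  have h1 := Finset.card_le_univ (exploreInit o a).Aᶜ
  have h2 := Finset.card_le_univ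
    (((exploreInit o a).L.toFinset ∪ (exploreInit o a).F).image Prod.fst)
  unfold exploreMeasure
  omega

end Exploration

end TreeGraph

/-!
The determinant of the lifted Schrödinger operator `ℒ` factors as `∏ det (L_W) ^ m W`, over the
strongly connected sets `W` of vertices. Since the polynomials `det (L_W)` are pairwise
non-associated primes, the exponent of `det (L_W)` is its multiplicity in `det ℒ`.

*Primality.* After a linear change of variables (`shiftEquiv`) the entries of `L_W` that do not vanish
identically are distinct variables, so the determinant has degree one in the variables of each row and
of each column. In a factorization, the variables of a row, or of a column, therefore all occur in the
same factor, and along the edges of the strongly connected graph on `W` one sees that this factor is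
the same for all rows (`prime_det_genericOn`). All these variables do occur; for the `x e` this
follows from the maximum principle for the Laplacian (`inl_mem_vars_det_genericOn`).

*Traces.* The trace of `ℒ ^ n` is a sum over closed walks in the tree graph, which are lifts of closed
walks of `G` (walks may pause at a vertex, with the diagonal entry as weight). The lift of a closed
walk from `w` to `w` that starts at the tree `a` is closed exactly if `a` coincides, on the set `X` of
vertices of the walk, with the tree of last exits of the walk. The number of such trees `a` is the
number `N X` of spanning forests of `G` with set of roots `X` (`card_closed_lifts`).

*Exploration.* For a strongly connected set `X` with `w ∈ X`, the number `N X` is also the number of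
trees `a` with root `w` and `X ⊆ ψ a` (`card_subset_psi`): the algorithm examines one edge out of each
vertex that it meets, the trees for which `X` gets explored are those that contain the edges examined
out of the vertices of `X`, and the decisions at the other vertices are the same as for forests rooted
at `X` (`card_explored_eq_forestCount`). It follows, by inclusion-exclusion, that `m W w` depends
neither on `w` nor on the order (`mult_eq_mult`). It also follows that the trace of `ℒ ^ n` is the sum
over all trees `a` of the diagonal entries at the root of `a` of the powers `L_{ψ a} ^ n`, which is
`∑ m W * tr (L_W ^ n)` (`trace_treeSchrodinger_pow`). In characteristic zero the traces of the powers
determine the determinant (`det_eq_prod_of_trace_pow`), and this is the factorization.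
-/

namespace TreeGraph

/-! ### Determinants and traces of powers -/

section Traces

open Polynomial

theorem det_aeval_eq_prod_roots {K n : Type*} [Field K] [IsAlgClosed K] [Fintype n]
    [DecidableEq n] (A : Matrix n n K) (p : K[X]) :
    (aeval A p).det = (A.charpoly.roots.map fun l => p.eval l).prod := by
  have hcard : A.charpoly.roots.card = Fintype.card n := by
    rw [← (IsAlgClosed.splits A.charpoly).natDegree_eq_card_roots,
      Matrix.charpoly_natDegree_eq_dim]
  have hlin : ∀ a : K, (aeval A (X - C a)).det
      = (A.charpoly.roots.map fun l => (X - C a).eval l).prod := by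
    intro a
    have h1 : A.charpoly.eval a = (A.charpoly.roots.map fun l => a - l).prod := by
      conv_lhs => rw [(IsAlgClosed.splits A.charpoly).eq_prod_roots_of_monic A.charpoly_monic]
      simp [eval_multiset_prod, Multiset.map_map]
    have h2 : aeval A (X - C a) = -(Matrix.scalar n a - A) := by
      simp [Matrix.algebraMap_eq_diagonal, Pi.algebraMap_def]
    have h3 : (A.charpoly.roots.map fun l => (X - C a).eval l)
        = (A.charpoly.roots.map fun l => a - l).map Neg.neg := by
      simp [Multiset.map_map]
    rw [h2, Matrix.det_neg, ← Matrix.eval_charpoly, h1, h3, Multiset.prod_map_neg,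
      Multiset.card_map, hcard]
  have hmul : ∀ m : Multiset K, (aeval A (m.map fun a => X - C a).prod).det
      = (A.charpoly.roots.map fun l => ((m.map fun a => X - C a).prod).eval l).prod := by
    intro m
    induction m using Multiset.induction_on with
    | empty => simp
    | cons a m ih =>
      simp only [Multiset.map_cons, Multiset.prod_cons, map_mul, Matrix.det_mul, eval_mul,
        Multiset.prod_map_mul, ih, hlin]
  have hp := (IsAlgClosed.splits p).eq_prod_roots
  rw [hp, map_mul, Matrix.det_mul, hmul]
  simp only [eval_mul, Multiset.prod_map_mul, aeval_C, eval_C, Multiset.map_const',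
    Multiset.prod_replicate, hcard]
  congr 1
  simp [Matrix.algebraMap_eq_diagonal, Pi.algebraMap_def]

theorem trace_aeval_eq_sum_roots {K n : Type*} [Field K] [IsAlgClosed K] [Fintype n]
    [DecidableEq n] (A : Matrix n n K) (p : K[X]) :
    (aeval A p).trace = (A.charpoly.roots.map fun l => p.eval l).sum := by
  have h : (aeval A p).charpoly
      = ((A.charpoly.roots.map fun l => p.eval l).map fun a => X - C a).prod := by
    refine Polynomial.funext fun s => ?_
    have h2 : Matrix.scalar n s - aeval A p = aeval A (C s - p) := by
      simp [Matrix.algebraMap_eq_diagonal, Pi.algebraMap_def]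
    rw [Matrix.eval_charpoly, h2, det_aeval_eq_prod_roots, eval_multiset_prod]
    simp [Multiset.map_map]
  rw [Matrix.trace_eq_sum_roots_charpoly, h, roots_multiset_prod_X_sub_C]

/-- In characteristic zero the power sums determine a finite multiset: testing against the
polynomial that vanishes at all the other points isolates the multiplicity of a single point. -/
theorem multiset_eq_of_power_sums {K : Type*} [Field K] [CharZero K] {s t : Multiset K}
    (h : ∀ k : ℕ, (s.map (· ^ k)).sum = (t.map (· ^ k)).sum) : s = t := by
  classical
  have hp : ∀ p : K[X], (s.map fun a => p.eval a).sum = (t.map fun a => p.eval a).sum := by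
    intro p
    have hu : ∀ u : Multiset K, (u.map fun a => p.eval a).sum
        = ∑ i ∈ Finset.range (p.natDegree + 1), p.coeff i * (u.map (· ^ i)).sum := by
      intro u
      simp only [eval_eq_sum_range, ← Multiset.sum_map_mul_left]
      exact Multiset.sum_map_sum_map u (Finset.range (p.natDegree + 1)).val
    simp only [hu, h]
  ext a
  set p : K[X] := ∏ b ∈ (s + t).toFinset.erase a, (X - C b) with hpdef
  have hpa : p.eval a ≠ 0 := by
    rw [hpdef, eval_prod, Finset.prod_ne_zero_iff]
    intro b hb
    simpa [sub_eq_zero] using (Finset.ne_of_mem_erase hb).symm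
  have hpb : ∀ b ∈ s + t, b ≠ a → p.eval b = 0 := by
    intro b hb hba
    rw [hpdef, eval_prod]
    exact Finset.prod_eq_zero (Finset.mem_erase.2 ⟨hba, Multiset.mem_toFinset.2 hb⟩) (by simp)
  have hsum : ∀ u : Multiset K, u ≤ s + t →
      (u.map fun b => p.eval b).sum = u.count a * p.eval a := by
    intro u hu
    rw [Finset.sum_multiset_map_count, Finset.sum_eq_single a]
    · simp
    · intro b hb hba
      rw [hpb b (Multiset.mem_of_le hu (Multiset.mem_toFinset.1 hb)) hba, smul_zero]
    · intro ha
      rw [Multiset.count_eq_zero.2 (fun h => ha (Multiset.mem_toFinset.2 h)), zero_smul]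
  have := hp p
  rw [hsum s (Multiset.le_add_right s t), hsum t (Multiset.le_add_left t s)] at this
  exact_mod_cast mul_right_cancel₀ hpa this

/-- If the traces of all powers of `A` are those of a block diagonal matrix with `m i` blocks equal
to `B i`, then so is the determinant. -/
theorem det_eq_prod_of_trace_pow {R n ι : Type*} [CommRing R] [IsDomain R] [CharZero R]
    [Fintype n] [DecidableEq n] (A : Matrix n n R) (s : Finset ι) (κ : ι → Type*)
    [∀ i, Fintype (κ i)] [∀ i, DecidableEq (κ i)] (B : ∀ i, Matrix (κ i) (κ i) R) (m : ι → ℕ)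
    (h : ∀ k : ℕ, (A ^ k).trace = ∑ i ∈ s, m i * (B i ^ k).trace) :
    A.det = ∏ i ∈ s, (B i).det ^ m i := by
  let K := AlgebraicClosure (FractionRing R)
  let φ : R →+* K := (algebraMap (FractionRing R) K).comp (algebraMap R (FractionRing R))
  have hφ : Function.Injective φ :=
    (algebraMap (FractionRing R) K).injective.comp (IsFractionRing.injective R (FractionRing R))
  have : CharZero K := charZero_of_injective_ringHom hφ
  have hpow : ∀ {o : Type _} [Fintype o] [DecidableEq o] (M : Matrix o o R) (k : ℕ),
      φ (M ^ k).trace = (((M.map φ).charpoly.roots).map (· ^ k)).sum := by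
    intro o _ _ M k
    have h1 := trace_aeval_eq_sum_roots (M.map φ) (X ^ k)
    simp only [map_pow, aeval_X, eval_pow, eval_X] at h1
    rw [← h1, ← RingHom.mapMatrix_apply, ← map_pow, AddMonoidHom.map_trace φ]
    rfl
  have hpow' : ∀ (i : ι) (k : ℕ),
      φ ((B i) ^ k).trace = ((((B i).map φ).charpoly.roots).map (· ^ k)).sum := by
    intro i k
    have h1 := trace_aeval_eq_sum_roots ((B i).map φ) (X ^ k)
    simp only [map_pow, aeval_X, eval_pow, eval_X] at h1
    rw [← h1, ← RingHom.mapMatrix_apply, ← map_pow, AddMonoidHom.map_trace φ]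
    rfl
  have key : (A.map φ).charpoly.roots = ∑ i ∈ s, m i • ((B i).map φ).charpoly.roots := by
    refine multiset_eq_of_power_sums fun k => ?_
    rw [← hpow, h, map_sum]
    have : ∀ u : Finset ι, ((∑ i ∈ u, m i • ((B i).map φ).charpoly.roots).map (· ^ k)).sum
        = ∑ i ∈ u, φ (m i * (B i ^ k).trace) := by
      intro u
      rw [← Multiset.coe_mapAddMonoidHom, map_sum, ← Multiset.coe_sumAddMonoidHom, map_sum]
      refine Finset.sum_congr rfl fun i _ => ?_
      rw [map_nsmul, map_nsmul, map_mul, hpow', map_natCast, nsmul_eq_mul]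
      rfl
    exact (this s).symm
  apply hφ
  have hdet : ∀ i, φ (B i).det = ((B i).map φ).charpoly.roots.prod := by
    intro i
    rw [← Matrix.det_eq_prod_roots_charpoly, RingHom.map_det]
    rfl
  rw [RingHom.map_det, RingHom.mapMatrix_apply, Matrix.det_eq_prod_roots_charpoly, key, map_prod,
    Multiset.prod_sum]
  refine Finset.prod_congr rfl fun i _ => ?_
  rw [Multiset.prod_nsmul, map_pow, hdet]

end Traces

/-! ### Irreducibility of the determinants -/

section Irreducible

open MvPolynomial

section Scaling

variable {σ R : Type*} [CommRing R]

open Classical in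
/-- The substitution that multiplies each variable in `S` by a new variable `T`; the degree in `T`
of the image is the total degree in the variables of `S`. -/
noncomputable def scaleHom (S : Set σ) :
    MvPolynomial σ R →ₐ[R] Polynomial (MvPolynomial σ R) :=
  aeval fun i => if i ∈ S then Polynomial.X * Polynomial.C (X i) else Polynomial.C (X i)

theorem eval_one_scaleHom (S : Set σ) (f : MvPolynomial σ R) :
    (scaleHom S f).eval 1 = f := by
  have : ((Polynomial.aeval (1 : MvPolynomial σ R)).restrictScalars R).comp (scaleHom S)
      = AlgHom.id R (MvPolynomial σ R) := by
    ext i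
    by_cases hi : i ∈ S <;> simp [scaleHom, hi]
  simpa [Polynomial.coe_aeval_eq_eval] using DFunLike.congr_fun this f

theorem notMem_of_natDegree_scaleHom_eq_zero {S : Set σ} {f : MvPolynomial σ R}
    (h : (scaleHom S f).natDegree = 0) {i : σ} (hi : i ∈ f.vars) : i ∉ S := by
  classical
  rcases subsingleton_or_nontrivial R with hR | hR
  · simp [Subsingleton.elim f 0] at hi
  have h0 : (scaleHom S f).eval 0 = bind₁ (fun i => if i ∈ S then 0 else X i) f := by
    have : ((Polynomial.aeval (0 : MvPolynomial σ R)).restrictScalars R).comp (scaleHom S)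
        = bind₁ (fun i => if i ∈ S then (0 : MvPolynomial σ R) else X i) := by
      ext i
      by_cases hi : i ∈ S <;> simp [scaleHom, hi]
    simpa [Polynomial.coe_aeval_eq_eval] using DFunLike.congr_fun this f
  have hf : f = bind₁ (fun i => if i ∈ S then (0 : MvPolynomial σ R) else X i) f := by
    rw [← h0]
    conv_lhs => rw [← eval_one_scaleHom S f]
    rw [Polynomial.eq_C_of_natDegree_eq_zero h, Polynomial.eval_C, Polynomial.eval_C]
  rw [hf] at hi
  have := vars_bind₁ _ _ hi
  simp only [Finset.mem_biUnion] at this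
  obtain ⟨j, -, hj⟩ := this
  intro hiS
  split_ifs at hj with hjS
  · simp at hj
  · rw [vars_X, Finset.mem_singleton] at hj
    exact hjS (hj ▸ hiS)

/-- If a product has degree at most one in the variables of `S`, then these variables cannot occur
in both factors. -/
theorem false_of_mem_vars_of_natDegree_scaleHom_le_one [IsDomain R] {S : Set σ}
    {f g : MvPolynomial σ R} (hfg : f * g ≠ 0) (h : (scaleHom S (f * g)).natDegree ≤ 1)
    {i j : σ} (hi : i ∈ f.vars) (hiS : i ∈ S) (hj : j ∈ g.vars) (hjS : j ∈ S) : False := by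
  have hne : ∀ p : MvPolynomial σ R, p ≠ 0 → scaleHom S p ≠ 0 := by
    intro p hp h0
    apply hp
    rw [← eval_one_scaleHom S p, h0, Polynomial.eval_zero]
  rw [map_mul, Polynomial.natDegree_mul (hne _ (left_ne_zero_of_mul hfg))
    (hne _ (right_ne_zero_of_mul hfg))] at h
  have h1 : (scaleHom S f).natDegree ≠ 0 :=
    fun h0 => notMem_of_natDegree_scaleHom_eq_zero h0 hi hiS
  have h2 : (scaleHom S g).natDegree ≠ 0 :=
    fun h0 => notMem_of_natDegree_scaleHom_eq_zero h0 hj hjS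
  omega

theorem natDegree_det_le_one {n : Type*} [Fintype n] [DecidableEq n]
    (M : Matrix n n (Polynomial R)) (i₀ : n) (h : ∀ i j, (M i j).natDegree ≤ if i = i₀ then 1 else 0) :
    M.det.natDegree ≤ 1 := by
  rw [← Matrix.det_transpose, Matrix.det_apply]
  refine Polynomial.natDegree_sum_le_of_forall_le _ _ fun τ _ => ?_
  refine (Polynomial.natDegree_smul_le _ _).trans ?_
  refine (Polynomial.natDegree_prod_le _ _).trans ?_
  refine (Finset.sum_le_sum fun i _ => h i (τ i)).trans ?_
  simp

end Scaling

variable {V : Type*} [DecidableEq V] (G : Digraph V) [DecidableRel G.Adj]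

/-- The matrix indexed by `W` with the variables `y v` on the diagonal and the variables `x e`,
for the edges `e` of `G` inside `W`, off the diagonal. -/
noncomputable def genericOn (W : Finset V) : Matrix W W (Poly G) := fun v w =>
  if v = w then y G v else if h : G.Adj v w then x ⟨(v, w), h⟩ else 0

/-- The row of the matrix `genericOn` in which a variable lies. -/
def rowIdx : Edge G ⊕ V → V := Sum.elim (fun e => e.1.1) id

/-- The column of the matrix `genericOn` in which a variable lies. -/
def colIdx : Edge G ⊕ V → V := Sum.elim (fun e => e.1.2) id

variable {G}

theorem natDegree_scaleHom_X_le {σ : Type*} (S : Set σ) (i : σ) [Decidable (i ∈ S)] :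
    (scaleHom S (X i : MvPolynomial σ ℂ)).natDegree ≤ if i ∈ S then 1 else 0 := by
  by_cases hi : i ∈ S
  · simp [scaleHom, hi]
  · simp [scaleHom, hi]

/-- The determinant has degree one in the variables of each row and of each column. The variables
that do not lie in any row (column) of `W` do not occur, so they can be counted as well. -/
theorem natDegree_scaleHom_det_genericOn_le (W : Finset V) (v : V) (hv : v ∈ W) :
    (scaleHom {i | rowIdx G i ∉ W ∨ rowIdx G i = v} (genericOn G W).det).natDegree ≤ 1 ∧
    (scaleHom {i | colIdx G i ∉ W ∨ colIdx G i = v} (genericOn G W).det).natDegree ≤ 1 := by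
  classical
  constructor
  · rw [AlgHom.map_det]
    refine natDegree_det_le_one _ ⟨v, hv⟩ fun i j => ?_
    simp only [AlgHom.mapMatrix_apply, Matrix.map_apply, genericOn]
    have hi := i.2
    split_ifs with h1 h2 h2 h3 h3
    · exact (natDegree_scaleHom_X_le _ _).trans (by split_ifs <;> simp)
    · refine (natDegree_scaleHom_X_le _ _).trans ?_
      rw [if_neg (by simpa [rowIdx, Subtype.ext_iff] using h2)]
    · exact (natDegree_scaleHom_X_le _ _).trans (by split_ifs <;> simp)
    · refine (natDegree_scaleHom_X_le _ _).trans ?_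
      rw [if_neg (by simpa [rowIdx, Subtype.ext_iff] using h3)]
    · simp
    · simp
  · rw [AlgHom.map_det, ← Matrix.det_transpose]
    refine natDegree_det_le_one _ ⟨v, hv⟩ fun i j => ?_
    simp only [AlgHom.mapMatrix_apply, Matrix.map_apply, genericOn, Matrix.transpose_apply]
    have hi := i.2
    split_ifs with h1 h2 h2 h3 h3
    · exact (natDegree_scaleHom_X_le _ _).trans (by split_ifs <;> simp)
    · refine (natDegree_scaleHom_X_le _ _).trans ?_
      rw [if_neg (by simpa [colIdx, h1, Subtype.ext_iff] using h2)]
    · exact (natDegree_scaleHom_X_le _ _).trans (by split_ifs <;> simp)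
    · refine (natDegree_scaleHom_X_le _ _).trans ?_
      rw [if_neg (by simpa [colIdx, Subtype.ext_iff] using h3)]
    · simp
    · simp

theorem mem_vars_of_eval_ne {σ : Type*} {p : MvPolynomial σ ℂ} {i : σ} {g₁ g₂ : σ → ℂ}
    (hg : ∀ j, j ≠ i → g₁ j = g₂ j) (h : eval g₁ p ≠ eval g₂ p) : i ∈ p.vars := by
  by_contra hi
  apply h
  exact eval₂Hom_congr' rfl (fun j hj _ => hg j (fun hji => hi (hji ▸ hj))) rfl

theorem eval_det_genericOn (W : Finset V) (g : Edge G ⊕ V → ℂ) :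
    eval g (genericOn G W).det = Matrix.det (Matrix.of fun v w : W =>
      if v = w then g (Sum.inr v) else if h : G.Adj v w then g (Sum.inl ⟨(v, w), h⟩) else 0) := by
  rw [RingHom.map_det]
  congr 1
  ext v w
  simp only [RingHom.mapMatrix_apply, Matrix.map_apply, genericOn, Matrix.of_apply]
  split_ifs <;> simp [x, y]

theorem eval_diagonal_det_genericOn (W : Finset V) (g : Edge G ⊕ V → ℂ)
    (hg : ∀ e, g (Sum.inl e) = 0) :
    eval g (genericOn G W).det = ∏ v ∈ W, g (Sum.inr v) := by
  rw [eval_det_genericOn, ← Finset.prod_coe_sort, ← Matrix.det_diagonal]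
  congr 1
  ext v w
  simp [Matrix.diagonal_apply, hg]

theorem inr_mem_vars_det_genericOn (W : Finset V) (v : V) (hv : v ∈ W) :
    Sum.inr v ∈ (genericOn G W).det.vars := by
  refine mem_vars_of_eval_ne (g₁ := Sum.elim 0 1) (g₂ := Sum.elim 0 (Function.update 1 v 0)) ?_ ?_
  · rintro (e | u) hu
    · rfl
    · have : u ≠ v := fun h => hu (h ▸ rfl)
      simp [this]
  · rw [eval_diagonal_det_genericOn _ _ (by simp), eval_diagonal_det_genericOn _ _ (by simp),
      Finset.prod_eq_zero (f := fun u => Sum.elim (0 : Edge G → ℂ) (Function.update 1 v 0)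
        (Sum.inr u)) hv (by simp)]
    simp

theorem mulVec_laplacian_row (hloop : ∀ v, ¬ G.Adj v v) (W : Finset V) (c : Edge G → ℂ)
    (z : W → ℂ) (v : W) :
    ((Matrix.of fun v w : W =>
      if v = w then ((W.filter (G.Adj v)).card : ℂ)
      else if h : G.Adj v w then -c ⟨(v, w), h⟩ else 0).mulVec z) v
      = ∑ w : W, if h : G.Adj v w then z v - c ⟨(v, w), h⟩ * z w else 0 := by
  have hcard : ((W.filter (G.Adj v)).card : ℂ) = ∑ w : W, if G.Adj v w then (1 : ℂ) else 0 := by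
    rw [Finset.sum_coe_sort W (fun w => if G.Adj v w then (1 : ℂ) else 0), Finset.sum_boole]
  have h1 : ∀ w : W, (if v = w then ((W.filter (G.Adj v)).card : ℂ)
      else if h : G.Adj v w then -c ⟨(v, w), h⟩ else 0) * z w
      = (if v = w then ((W.filter (G.Adj v)).card : ℂ) * z w else 0)
        + (if h : G.Adj v w then -c ⟨(v, w), h⟩ * z w else 0) := by
    intro w
    by_cases hvw : v = w
    · subst hvw
      simp [hloop]
    · by_cases h : G.Adj v w <;> simp [hvw, h]
  simp only [Matrix.mulVec, dotProduct, Matrix.of_apply, h1, Finset.sum_add_distrib,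
    Finset.sum_ite_eq, Finset.mem_univ, if_true]
  rw [hcard, Finset.sum_mul, ← Finset.sum_add_distrib]
  refine Finset.sum_congr rfl fun w _ => ?_
  split_ifs <;> ring

/-- Evaluating at `x e = -1`, with the out-degrees inside `W` for the `y v`, gives the Laplacian of
the induced graph, whose rows sum to zero. Once the variable of a single edge is put to zero instead,
the maximum principle shows that the kernel is trivial: the vertices at which a vector of the kernel
has maximal modulus would include the source of that edge. -/
theorem inl_mem_vars_det_genericOn (hloop : ∀ v, ¬ G.Adj v v) (W : Finset V)
    (hW : StronglyConnected G W) (e : Edge G) (h1 : e.1.1 ∈ W) (h2 : e.1.2 ∈ W) :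
    Sum.inl e ∈ (genericOn G W).det.vars := by
  classical
  let d : V → ℂ := fun v => ((W.filter (G.Adj v)).card : ℂ)
  let c : Edge G → ℂ := fun e' => if e' = e then 0 else 1
  refine mem_vars_of_eval_ne (g₁ := Sum.elim (fun _ => -1) d)
    (g₂ := Sum.elim (fun e' => -c e') d) ?_ ?_
  · rintro (e' | u) hu
    · have : e' ≠ e := fun h => hu (h ▸ rfl)
      simp [this, c]
    · rfl
  · have hz1 : eval (Sum.elim (fun _ => -1) d) (genericOn G W).det = 0 := by
      rw [eval_det_genericOn, ← Matrix.exists_mulVec_eq_zero_iff]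
      refine ⟨1, fun h => ?_, ?_⟩
      · simpa using congrFun h ⟨e.1.1, h1⟩
      · ext v
        refine (mulVec_laplacian_row hloop W (fun _ => 1) 1 v).trans ?_
        simp
    rw [hz1]
    intro h0
    rw [eval_det_genericOn, eq_comm, ← Matrix.exists_mulVec_eq_zero_iff] at h0
    obtain ⟨z, hz, hMz⟩ := h0
    have hrow : ∀ v : W, ∑ w : W, (if h : G.Adj v w then z v - c ⟨(v, w), h⟩ * z w else 0) = 0 :=
      fun v => (mulVec_laplacian_row hloop W c z v).symm.trans (congrFun hMz v)
    have : Nonempty W := ⟨⟨_, h1⟩⟩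
    obtain ⟨u₀, hu₀⟩ := Finite.exists_max fun u : W => ‖z u‖
    have hpos : 0 < ‖z u₀‖ := by
      obtain ⟨u, hu⟩ := Function.ne_iff.1 hz
      exact (norm_pos_iff.2 hu).trans_le (hu₀ u)
    have hc1 : ∀ e', ‖c e'‖ ≤ 1 := by
      intro e'
      by_cases h : e' = e <;> simp [c, h]
    have hle : ∀ v w : W, ∀ h : G.Adj v w, ‖c ⟨(v, w), h⟩ * z w‖ ≤ ‖z u₀‖ := by
      intro v w h
      rw [norm_mul]
      exact (mul_le_of_le_one_left (norm_nonneg _) (hc1 _)).trans (hu₀ w)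
    have hstep : ∀ v w : W, ‖z v‖ = ‖z u₀‖ → ∀ h : G.Adj v w,
        ‖c ⟨(v, w), h⟩ * z w‖ = ‖z u₀‖ := by
      intro v w hv h
      have hsum : ∑ w : W, (if G.Adj v w then z v else 0)
          = ∑ w : W, (if h : G.Adj v w then c ⟨(v, w), h⟩ * z w else 0) := by
        rw [← sub_eq_zero, ← Finset.sum_sub_distrib, ← hrow v]
        refine Finset.sum_congr rfl fun w _ => ?_
        split_ifs <;> simp
      have h3 : ∑ w : W, (if G.Adj v w then ‖z u₀‖ else 0)
          ≤ ∑ w : W, (if h : G.Adj v w then ‖c ⟨(v, w), h⟩ * z w‖ else 0) := by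
        calc ∑ w : W, (if G.Adj v w then ‖z u₀‖ else 0)
            = ‖∑ w : W, (if G.Adj v w then z v else 0)‖ := by
              rw [← Finset.sum_filter, ← Finset.sum_filter, Finset.sum_const, Finset.sum_const,
                nsmul_eq_mul, nsmul_eq_mul, norm_mul, hv, Complex.norm_natCast]
          _ ≤ _ := by
              rw [hsum]
              refine (norm_sum_le _ _).trans (Finset.sum_le_sum fun w _ => ?_)
              split_ifs <;> simp
      have h4 : ∀ w ∈ Finset.univ (α := W),
          (if h : G.Adj v w then ‖c ⟨(v, w), h⟩ * z w‖ else 0)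
            ≤ if G.Adj v w then ‖z u₀‖ else 0 := by
        intro w _
        split_ifs with h
        · exact hle v w h
        · rfl
      have h5 := (Finset.sum_eq_sum_iff_of_le h4).1 (le_antisymm (Finset.sum_le_sum h4) h3) w
        (Finset.mem_univ w)
      simpa [h] using h5
    have hreach : ∀ v, ReachIn G W u₀ v → ∀ hv : v ∈ W, ‖z ⟨v, hv⟩‖ = ‖z u₀‖ := by
      intro v hv
      induction hv with
      | refl => exact fun _ => rfl
      | @tail u w _ huw ih =>
        intro hw
        refine le_antisymm (hu₀ _) ?_
        rw [← hstep ⟨u, huw.1⟩ ⟨w, hw⟩ (ih huw.1) huw.2.2, norm_mul]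
        exact mul_le_of_le_one_left (norm_nonneg _) (hc1 _)
    have hend := hstep ⟨e.1.1, h1⟩ ⟨e.1.2, h2⟩ (hreach _ (hW.2 _ u₀.2 _ h1) h1) e.2
    simp only [c, if_true, zero_mul, norm_zero] at hend
    exact hpos.ne hend

theorem prime_det_genericOn (hloop : ∀ v, ¬ G.Adj v v) (W : Finset V)
    (hW : StronglyConnected G W) : Prime (genericOn G W).det := by
  classical
  set D := (genericOn G W).det with hD
  have hD1 : eval (Sum.elim 0 1) D = 1 := by
    rw [eval_diagonal_det_genericOn _ _ (by simp)]
    simp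
  have hD0 : D ≠ 0 := by
    intro h
    simp [h] at hD1
  obtain ⟨v₀, hv₀⟩ := hW.1
  -- A factor in which all the `y v` occur contains all the variables.
  have hunit : ∀ f g : Poly G, D = f * g → (∀ v ∈ W, Sum.inr v ∈ f.vars) → IsUnit g := by
    intro f g hfg hf
    have hg : g.vars = ∅ := by
      rw [Finset.eq_empty_iff_forall_notMem]
      intro i hi
      have key : ∀ v ∈ W, (rowIdx G i ∉ W ∨ rowIdx G i = v) → False := fun v hv hiv =>
        false_of_mem_vars_of_natDegree_scaleHom_le_one (hfg ▸ hD0)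
          (by rw [← hfg]; exact (natDegree_scaleHom_det_genericOn_le (G := G) W v hv).1)
          (hf v hv) (Or.inr rfl) hi hiv
      by_cases hiW : rowIdx G i ∈ W
      · exact key _ hiW (Or.inr rfl)
      · exact key v₀ hv₀ (Or.inl hiW)
    rw [vars_eq_empty_iff_eq_C] at hg
    rw [isUnit_iff_eq_C_of_isReduced]
    refine ⟨g.coeff 0, isUnit_iff_ne_zero.2 fun h0 => hD0 ?_, hg⟩
    rw [hfg, hg, h0, C_0, mul_zero]
  have hprop : ∀ f g : Poly G, D = f * g → Sum.inr v₀ ∈ f.vars → IsUnit g := by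
    intro f g hfg hf
    have hfg0 := hfg ▸ hD0
    refine hunit f g hfg fun v hv => ?_
    have := hW.2 v₀ hv₀ v hv
    induction this with
    | refl => exact hf
    | @tail u w _ huw ih =>
      obtain ⟨hu, hw, huw⟩ := huw
      have hrow := (natDegree_scaleHom_det_genericOn_le (G := G) W u hu).1
      have hcol := (natDegree_scaleHom_det_genericOn_le (G := G) W w hw).2
      have hx := inl_mem_vars_det_genericOn hloop W hW ⟨(u, w), huw⟩ hu hw
      have hy := inr_mem_vars_det_genericOn (G := G) W w hw
      rw [← hD, hfg] at hx hy hrow hcol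
      have hxf : Sum.inl ⟨(u, w), huw⟩ ∈ f.vars := by
        refine (Finset.mem_union.1 (vars_mul _ _ hx)).resolve_right fun hxg => ?_
        exact false_of_mem_vars_of_natDegree_scaleHom_le_one hfg0 hrow
          (ih hu) (Or.inr rfl) hxg (Or.inr rfl)
      refine (Finset.mem_union.1 (vars_mul _ _ hy)).resolve_right fun hyg => ?_
      exact false_of_mem_vars_of_natDegree_scaleHom_le_one hfg0 hcol
        hxf (Or.inr rfl) hyg (Or.inr rfl)
  refine Irreducible.prime ⟨fun hu => ?_, fun f g hfg => ?_⟩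
  · rw [isUnit_iff_eq_C_of_isReduced] at hu
    obtain ⟨r, -, hr⟩ := hu
    have := inr_mem_vars_det_genericOn (G := G) W v₀ hv₀
    rw [← hD, hr, vars_C] at this
    simp at this
  · have hy := inr_mem_vars_det_genericOn (G := G) W v₀ hv₀
    rw [← hD, hfg] at hy
    rcases Finset.mem_union.1 (vars_mul _ _ hy) with h | h
    · exact Or.inr (hprop f g hfg h)
    · exact Or.inl (hprop g f (hfg.trans (mul_comm _ _)) h)

end Irreducible

section ChangeOfVariables

open MvPolynomial

variable {V : Type*} [Fintype V] [DecidableEq V] (G : Digraph V) [DecidableRel G.Adj]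

/-- The change of variables that adds to `y v` the sum of the `x e` over the edges `e` out of `v`.
It turns the Schrödinger operator into a matrix with independent entries. -/
noncomputable def shiftEquiv : Poly G ≃ₐ[ℂ] Poly G :=
  AlgEquiv.ofAlgHom
    (aeval (Sum.elim (fun e => x e)
      fun v => y G v + ∑ e : Edge G, if e.1.1 = v then x e else 0))
    (aeval (Sum.elim (fun e => x e)
      fun v => y G v - ∑ e : Edge G, if e.1.1 = v then x e else 0))
    (by
      ext i
      rcases i with e | v
      · simp [x]
      · simp [x, y, apply_ite])
    (by
      ext i
      rcases i with e | v
      · simp [x]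
      · simp [x, y, apply_ite])

theorem shiftEquiv_det (W : Finset V) :
    shiftEquiv G (schrodingerOn G W).det = (genericOn G W).det := by
  rw [AlgEquiv.map_det]
  congr 1
  ext1 v w
  simp only [AlgEquiv.mapMatrix_apply, Matrix.map_apply, schrodingerOn, Matrix.submatrix_apply,
    schrodinger, Matrix.add_apply, laplacian, Matrix.diagonal_apply, genericOn, Subtype.ext_iff]
  split_ifs <;> simp [shiftEquiv, x, y, apply_ite]

variable {G}

theorem prime_det_schrodingerOn (hloop : ∀ v, ¬ G.Adj v v) (W : Finset V)
    (hW : StronglyConnected G W) : Prime (schrodingerOn G W).det := by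
  rw [← MulEquiv.prime_iff (shiftEquiv G).toMulEquiv]
  exact (shiftEquiv_det G W) ▸ prime_det_genericOn hloop W hW

/-- If `v ∈ W₁` is not in `W₂`, then after the change of variables the point where all the `x e` and
`y v` are `0` and the other `y u` are `1` is a zero of the determinant for `W₁` but not of the one for
`W₂`. -/
theorem subset_of_det_schrodingerOn_dvd {W₁ W₂ : Finset V}
    (h : (schrodingerOn G W₁).det ∣ (schrodingerOn G W₂).det) : W₁ ⊆ W₂ := by
  intro v hv
  by_contra hv2
  have h1 := map_dvd (shiftEquiv G) h
  rw [shiftEquiv_det, shiftEquiv_det] at h1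
  have h2 := map_dvd (eval (Sum.elim 0 (Function.update 1 v 0))) h1
  rw [eval_diagonal_det_genericOn _ _ (by simp), eval_diagonal_det_genericOn _ _ (by simp),
    Finset.prod_eq_zero hv (by simp), zero_dvd_iff, Finset.prod_eq_zero_iff] at h2
  obtain ⟨w, hw, h0⟩ := h2
  have : w ≠ v := fun h => hv2 (h ▸ hw)
  simp [this] at h0

end ChangeOfVariables

/-! ### Rooted forests as parent functions -/

section Forests

variable {V : Type*}

/-- `f` is the parent function of a spanning forest of `G` with set of roots `Z`: the roots are fixed,
and any other vertex is joined to its parent by an edge of `G` and has a root among its ancestors. -/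
structure IsForest (G : Digraph V) (Z : Set V) (f : V → V) : Prop where
  fixed : ∀ v ∈ Z, f v = v
  adj : ∀ v ∉ Z, G.Adj v (f v)
  reach : ∀ v, ∃ k : ℕ, f^[k] v ∈ Z

variable {G : Digraph V}

theorem reach_of_reach {Z Z' : Set V} {f f' : V → V}
    (h : ∀ v, f' v = f v ∨ ∃ k : ℕ, f'^[k] v ∈ Z') (hZ : ∀ v ∈ Z, ∃ k : ℕ, f'^[k] v ∈ Z') (v : V)
    (hv : ∃ k : ℕ, f^[k] v ∈ Z) : ∃ k : ℕ, f'^[k] v ∈ Z' := by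
  obtain ⟨k, hk⟩ := hv
  induction k generalizing v with
  | zero => exact hZ v hk
  | succ k ih =>
    rcases h v with h | h
    · obtain ⟨j, hj⟩ := ih (f v) hk
      exact ⟨j + 1, by rwa [Function.iterate_succ_apply, h]⟩
    · exact h

open Classical in
/-- Gluing: inside `Z` the forest is given by `g`, and outside `Z` it is arbitrary with roots in `Z`.
-/
theorem isForest_glue_iff {Z' Z : Set V} (hZ : Z' ⊆ Z) {g : V → V} (hfix : ∀ v ∈ Z', g v = v)
    (hmap : ∀ v ∈ Z, g v ∈ Z) (hadj : ∀ v ∈ Z, v ∉ Z' → G.Adj v (g v))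
    (hreach : ∀ v ∈ Z, ∃ k : ℕ, g^[k] v ∈ Z') {f : V → V} (hf : ∀ v ∈ Z, f v = g v) :
    IsForest G Z' f ↔ IsForest G Z (fun v => if v ∈ Z then v else f v) := by
  constructor
  · intro h
    refine ⟨fun v hv => by simp [hv], fun v hv => ?_, fun v => ?_⟩
    · simpa [hv] using h.adj v (fun h' => hv (hZ h'))
    · refine reach_of_reach (Z := Z') (fun u => ?_) (fun u hu => ⟨0, hZ hu⟩) v (h.reach v)
      by_cases hu : u ∈ Z
      · exact Or.inr ⟨0, hu⟩
      · exact Or.inl (by simp [hu])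
  · intro h
    have hin : ∀ v ∈ Z, ∃ k : ℕ, f^[k] v ∈ Z' := by
      intro v hv
      obtain ⟨k, hk⟩ := hreach v hv
      refine ⟨k, ?_⟩
      have : ∀ (k : ℕ) (u : V), u ∈ Z → f^[k] u = g^[k] u := by
        intro k
        induction k with
        | zero => exact fun _ _ => rfl
        | succ k ih =>
          intro u hu
          rw [Function.iterate_succ_apply, Function.iterate_succ_apply, hf u hu, ih _ (hmap u hu)]
      rwa [this k v hv]
    refine ⟨fun v hv => (hf v (hZ hv)).trans (hfix v hv), fun v hv => ?_, fun v => ?_⟩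
    · by_cases hvZ : v ∈ Z
      · rw [hf v hvZ]
        exact hadj v hvZ hv
      · simpa [hvZ] using h.adj v hvZ
    · refine reach_of_reach (Z := Z) (fun u => ?_) hin v (h.reach v)
      by_cases hu : u ∈ Z
      · exact Or.inr (hin u hu)
      · exact Or.inl (by simp [hu])

variable [Fintype V]

open Classical in
/-- The number of spanning forests of `G` with set of roots `Z` that contain none of the edges in
`R`. -/
noncomputable def forestCount [DecidableEq V] (G : Digraph V) (Z : Set V) (R : Finset (V × V)) : ℕ :=
  (Finset.univ.filter fun f : V → V => IsForest G Z f ∧ ∀ r ∈ R, f r.1 ≠ r.2).card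

variable [DecidableEq V]

open Classical in
theorem card_forests_extending {Z' Z : Set V} (hZ : Z' ⊆ Z) {g : V → V}
    (hfix : ∀ v ∈ Z', g v = v) (hmap : ∀ v ∈ Z, g v ∈ Z)
    (hadj : ∀ v ∈ Z, v ∉ Z' → G.Adj v (g v)) (hreach : ∀ v ∈ Z, ∃ k : ℕ, g^[k] v ∈ Z')
    (R : Finset (V × V)) (hR : ∀ r ∈ R, r.1 ∉ Z) :
    (Finset.univ.filter fun f : V → V =>
      IsForest G Z' f ∧ (∀ v ∈ Z, f v = g v) ∧ ∀ r ∈ R, f r.1 ≠ r.2).card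
      = forestCount G Z R := by
  have hglue := @isForest_glue_iff V G Z' Z hZ g hfix hmap hadj hreach
  refine Finset.card_bij' (fun f _ v => if v ∈ Z then v else f v)
    (fun f _ v => if v ∈ Z then g v else f v) ?_ ?_ ?_ ?_
  · intro f hf
    simp only [Finset.mem_filter, Finset.mem_univ, true_and] at hf ⊢
    refine ⟨(hglue hf.2.1).1 hf.1, fun r hr => ?_⟩
    simpa [hR r hr] using hf.2.2 r hr
  · intro f hf
    simp only [Finset.mem_filter, Finset.mem_univ, true_and] at hf ⊢
    refine ⟨(hglue fun v hv => by simp [hv]).2 ?_, fun v hv => by simp [hv], fun r hr => ?_⟩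
    · convert hf.1 using 1
      ext v
      by_cases hv : v ∈ Z
      · simp [hv, hf.1.fixed v hv]
      · simp [hv]
    · simpa [hR r hr] using hf.2 r hr
  · intro f hf
    simp only [Finset.mem_filter, Finset.mem_univ, true_and] at hf
    ext v
    by_cases hv : v ∈ Z
    · simp [hv, hf.2.1 v hv]
    · simp [hv]
  · intro f hf
    simp only [Finset.mem_filter, Finset.mem_univ, true_and] at hf
    ext v
    by_cases hv : v ∈ Z
    · simp [hv, hf.1.fixed v hv]
    · simp [hv]

/-- The forests are split according to whether they contain a given edge from `z` to `p ∈ Z`. In the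
first case `z` can be counted as a root. -/
theorem forestCount_eq_add {Z : Set V} {z p : V} (hz : z ∉ Z) (hp : p ∈ Z) (hzp : G.Adj z p)
    (R : Finset (V × V)) (hR : ∀ r ∈ R, r.1 ∉ insert z Z) :
    forestCount G Z R = forestCount G (insert z Z) R + forestCount G Z (insert (z, p) R) := by
  classical
  have hne : ∀ v ∈ Z, v ≠ z := fun v hv h => hz (h ▸ hv)
  rw [← card_forests_extending (G := G) (Z' := Z) (Z := insert z Z) (Set.subset_insert _ _)
    (g := Function.update id z p) (fun v hv => by simp [hne v hv]) ?_ ?_ ?_ R hR]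
  · unfold forestCount
    rw [← Finset.card_filter_add_card_filter_not (fun f : V → V => f z = p), Finset.filter_filter,
      Finset.filter_filter]
    congr 2
    · ext f
      simp only [Finset.mem_filter, Finset.mem_univ, true_and, Set.mem_insert_iff,
        forall_eq_or_imp, Function.update_self]
      constructor
      · rintro ⟨⟨h1, h2⟩, h3⟩
        exact ⟨h1, ⟨h3, fun v hv => by simp [hne v hv, h1.fixed v hv]⟩, h2⟩
      · rintro ⟨h1, ⟨h3, -⟩, h2⟩
        exact ⟨⟨h1, h2⟩, h3⟩
    · ext f
      simp only [Finset.mem_filter, Finset.mem_univ, true_and, Finset.mem_insert,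
        forall_eq_or_imp]
      tauto
  · rintro v (rfl | hv)
    · simp [hp]
    · simp [hne v hv, hv]
  · rintro v (rfl | hv) hv'
    · simpa using hzp
    · exact absurd hv hv'
  · rintro v (rfl | hv)
    · exact ⟨1, by simpa using hp⟩
    · exact ⟨0, hv⟩

end Forests

section Moving

variable {V : Type*} [DecidableEq V] {G : Digraph V}

/-- The effect on parent functions of moving the root from `r` to `u`. -/
def moveRoot (f : V → V) (r u : V) : V → V := Function.update (Function.update f r u) u u

theorem isForest_moveRoot {f : V → V} {r u : V} (h : IsForest G {r} f) (hru : G.Adj r u) :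
    IsForest G {u} (moveRoot f r u) := by
  refine ⟨?_, fun v hv => ?_, fun v => ?_⟩
  · rintro v rfl
    simp [moveRoot]
  · have hv : v ≠ u := hv
    by_cases hvr : v = r
    · subst hvr
      simpa [moveRoot, hv] using hru
    · simpa [moveRoot, hv, hvr] using h.adj v hvr
  · have hr : ∃ k : ℕ, (moveRoot f r u)^[k] r ∈ ({u} : Set V) := by
      by_cases hru : r = u
      · exact ⟨0, hru⟩
      · exact ⟨1, by simp [moveRoot, hru]⟩
    refine reach_of_reach (fun w => ?_) (by rintro _ rfl; exact hr) v (h.reach v)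
    by_cases hwu : w = u
    · exact Or.inr ⟨0, hwu⟩
    · by_cases hwr : w = r
      · exact Or.inr (hwr ▸ hr)
      · exact Or.inl (by simp [moveRoot, hwu, hwr])

end Moving

/-! ### Spanning trees as parent functions -/

section Trees

variable {V : Type*} {G : Digraph V}

open Classical in
/-- The parent function of a spanning tree; the root is its own parent. -/
noncomputable def SpanningTree.parent (a : SpanningTree G) (v : V) : V :=
  if h : v = a.root then v else (a.other_out v h).choose

theorem SpanningTree.parent_root (a : SpanningTree G) : a.parent a.root = a.root := by
  simp [SpanningTree.parent]

theorem SpanningTree.parent_mem (a : SpanningTree G) {v : V} (h : v ≠ a.root) :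
    (v, a.parent v) ∈ a.edges := by
  rw [SpanningTree.parent, dif_neg h]
  exact (a.other_out v h).choose_spec.1

theorem SpanningTree.mem_edges_iff (a : SpanningTree G) {e : V × V} :
    e ∈ a.edges ↔ e.1 ≠ a.root ∧ a.parent e.1 = e.2 := by
  obtain ⟨v, w⟩ := e
  constructor
  · intro h
    have hv : v ≠ a.root := by
      rintro rfl
      exact a.root_out w h
    exact ⟨hv, (a.other_out v hv).unique (a.parent_mem hv) h⟩
  · rintro ⟨hv, h⟩
    have := a.parent_mem hv
    rwa [h] at this

theorem SpanningTree.ext_edges {a b : SpanningTree G} (h : a.edges = b.edges) : a = b := by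
  refine SpanningTree.ext ?_ h
  by_contra hne
  exact a.root_out _ (h ▸ b.parent_mem hne)

theorem SpanningTree.ext_parent {a b : SpanningTree G} (hr : a.root = b.root)
    (h : a.parent = b.parent) : a = b := by
  apply SpanningTree.ext_edges
  ext e
  rw [a.mem_edges_iff, b.mem_edges_iff, hr, h]

variable [Fintype V]

theorem SpanningTree.isForest_parent (a : SpanningTree G) : IsForest G {a.root} a.parent := by
  refine ⟨?_, fun v hv => a.subgraph _ (a.parent_mem hv), fun v => ?_⟩
  · rintro v rfl
    exact a.parent_root
  · by_contra! hno
    have hpath : ∀ i d, Relation.TransGen (fun u w => (u, w) ∈ a.edges)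
        (a.parent^[i] v) (a.parent^[i + d + 1] v) := by
      intro i d
      have hs : ∀ j, (a.parent^[j] v, a.parent^[j + 1] v) ∈ a.edges := by
        intro j
        rw [Function.iterate_succ_apply']
        exact a.parent_mem (hno j)
      induction d with
      | zero => exact .single (hs i)
      | succ d ih => exact ih.tail (hs _)
    obtain ⟨i, j, hij, heq⟩ := Finite.exists_ne_map_eq_of_infinite fun k : ℕ => a.parent^[k] v
    wlog hlt : i < j generalizing i j
    · exact this j i hij.symm heq.symm (by omega)
    obtain ⟨d, rfl⟩ := Nat.exists_eq_add_of_lt hlt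
    exact a.acyclic _ (heq ▸ hpath i d)

variable [DecidableEq V]

/-- The spanning tree with a given parent function. -/
def treeOf {r : V} {f : V → V} (h : IsForest G {r} f) : SpanningTree G where
  root := r
  edges := Finset.univ.filter fun e => e.1 ≠ r ∧ f e.1 = e.2
  subgraph e he := by
    obtain ⟨h1, h2⟩ := (Finset.mem_filter.1 he).2
    exact h2 ▸ h.adj _ h1
  root_out w hw := (Finset.mem_filter.1 hw).2.1 rfl
  other_out v hv := ⟨f v, by simp [hv], fun w hw => by
    simp only [Finset.mem_filter] at hw
    exact hw.2.2.symm⟩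
  acyclic v hv := by
    have key : ∀ u, Relation.TransGen (fun u w => (u, w) ∈
        Finset.univ.filter fun e : V × V => e.1 ≠ r ∧ f e.1 = e.2) v u →
        v ≠ r ∧ ∃ k, f^[k + 1] v = u := by
      intro u hu
      induction hu with
      | single h =>
        have h := (Finset.mem_filter.1 h).2
        exact ⟨h.1, 0, h.2⟩
      | tail _ h ih =>
        have h := (Finset.mem_filter.1 h).2
        obtain ⟨h1, k, rfl⟩ := ih
        exact ⟨h1, k + 1, by rw [Function.iterate_succ_apply']; exact h.2⟩
    obtain ⟨hne, k, hk⟩ := key v hv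
    obtain ⟨j, hj⟩ := h.reach v
    have hr : ∀ i, f^[i] r = r := fun i => Function.iterate_fixed (h.fixed r rfl) i
    -- going around the cycle `j` times, one passes the root and stays there
    have h1 : f^[(k + 1) * j] v = v := by
      rw [Function.iterate_mul]
      exact Function.iterate_fixed hk j
    have h2 : (k + 1) * j = k * j + j := by ring
    rw [h2, Function.iterate_add_apply, hj, hr] at h1
    exact hne h1.symm

theorem parent_treeOf {r : V} {f : V → V} (h : IsForest G {r} f) : (treeOf h).parent = f := by
  ext v
  by_cases hv : v = r
  · subst hv
    exact (treeOf h).parent_root.trans (h.fixed v rfl).symm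
  · have := (treeOf h).parent_mem hv
    exact (Finset.mem_filter.1 this).2.2.symm

open Classical in
theorem card_trees_eq (w : V) (P : (V → V) → Prop) :
    (Finset.univ.filter fun a : SpanningTree G => a.root = w ∧ P a.parent).card
      = (Finset.univ.filter fun f : V → V => IsForest G {w} f ∧ P f).card := by
  refine Finset.card_bij (fun a _ => a.parent) ?_ ?_ ?_
  · intro a ha
    simp only [Finset.mem_filter, Finset.mem_univ, true_and] at ha ⊢
    exact ⟨ha.1 ▸ a.isForest_parent, ha.2⟩
  · intro a ha b hb hab
    simp only [Finset.mem_filter, Finset.mem_univ, true_and] at ha hb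
    exact SpanningTree.ext_parent (ha.1.trans hb.1.symm) hab
  · intro f hf
    simp only [Finset.mem_filter, Finset.mem_univ, true_and] at hf
    refine ⟨treeOf hf.1, ?_, parent_treeOf hf.1⟩
    simp only [Finset.mem_filter, Finset.mem_univ, true_and, parent_treeOf]
    exact ⟨rfl, hf.2⟩

open Classical in
/-- The spanning tree obtained from `a` by moving the root to `u` along an edge of `G`; if there is
no such edge, then the tree does not change. -/
noncomputable def treeMove (a : SpanningTree G) (u : V) : SpanningTree G :=
  if h : G.Adj a.root u then treeOf (isForest_moveRoot a.isForest_parent h) else a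

theorem root_treeMove (a : SpanningTree G) {u : V} (h : G.Adj a.root u) :
    (treeMove a u).root = u := by
  rw [treeMove, dif_pos h]
  rfl

theorem parent_treeMove (a : SpanningTree G) {u : V} (h : G.Adj a.root u) :
    (treeMove a u).parent = moveRoot a.parent a.root u := by
  rw [treeMove, dif_pos h, parent_treeOf]

theorem treeEdge_iff (hloop : ∀ v, ¬ G.Adj v v) (e : Edge G) (a c : SpanningTree G) :
    TreeEdge e a c ↔ e.1.1 = a.root ∧ c = treeMove a e.1.2 := by
  refine and_congr_right fun he => ?_
  obtain ⟨⟨r, u⟩, hru⟩ := e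
  simp only at he hru
  subst he
  have hedges : (treeMove a u).edges
      = (insert (a.root, u) a.edges).filter (fun f => f.1 ≠ u) := by
    ext ⟨v, w⟩
    have hne : a.root ≠ u := fun h => hloop u (h ▸ hru)
    simp only [SpanningTree.mem_edges_iff, root_treeMove a hru, parent_treeMove a hru,
      Finset.mem_filter, Finset.mem_insert, Prod.mk.injEq, moveRoot]
    by_cases hvu : v = u
    · simp [hvu]
    · by_cases hvr : v = a.root
      · subst hvr
        simp [hvu, eq_comm]
      · simp [hvu, hvr]
  simp only
  rw [← hedges]
  exact ⟨SpanningTree.ext_edges, fun h => h ▸ rfl⟩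

end Trees

/-! ### The exploration algorithm -/

section Explore

variable {V : Type*} [DecidableEq V] {G : Digraph V}

/-- The state after an iteration in which the first edge `e` of the list does not belong to the tree.
-/
def rejectEdge (s : ExploreState V) (e : V × V) : ExploreState V where
  A := s.A
  L := s.L.filter (fun f => f.1 ≠ e.1 ∧ f.2 ≠ e.1)
  F := s.F.filter (fun f => f.1 ≠ e.1 ∧ f.2 ≠ e.1)

/-- The invariants of the exploration of the trees with root `w` for which all vertices of `X` get
explored. The explored vertices form a tree with parent function `g`, and `R` is the set of the
rejected edges, except those with an explored source. No listed edge ends at the source of an earlier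
one, and so the rejection of an edge with an explored source does not lose any edge of the list that
leads to a new vertex. -/
structure ExplorationInv (G : Digraph V) (X : Finset V) (w : V) (g : V → V) (R : Finset (V × V))
    (s : ExploreState V) : Prop where
  root_mem : w ∈ s.A
  root_fixed : g w = w
  map_mem : ∀ v ∈ s.A, g v ∈ s.A
  adj : ∀ v ∈ s.A, v ≠ w → G.Adj v (g v)
  reach : ∀ v ∈ s.A, ∃ k : ℕ, g^[k] v = w
  list_adj : ∀ f ∈ s.L, G.Adj f.1 f.2
  list_ne : ∀ f ∈ s.L, f.1 ≠ w
  list_target : ∀ f ∈ s.L, f.2 ∈ s.A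
  list_source : ∀ f ∈ s.L, f.1 ∈ s.A → g f.1 ≠ f.2
  edges_adj : ∀ f ∈ s.F, G.Adj f.1 f.2
  edges_ne : ∀ f ∈ s.F, f.1 ≠ w
  fifo : s.L.Pairwise fun e f => f.2 ≠ e.1
  rejected_notMem : ∀ r ∈ R, r.1 ∉ s.A ∧ r.1 ∉ X
  rejected_list : ∀ r ∈ R, ∀ f ∈ s.L, f.1 ≠ r.1
  rejected_edges : ∀ r ∈ R, ∀ f ∈ s.F, f.1 ≠ r.1
  pending_list : ∀ u ∈ X, u ∉ s.A → ∀ v ∈ X, G.Adj u v → v ∈ s.A → (u, v) ∈ s.L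
  pending_edges : ∀ u ∈ X, u ∉ s.A → ∀ v ∈ X, G.Adj u v → v ∉ s.A → (u, v) ∈ s.F

namespace ExplorationInv

variable {X : Finset V} {w : V} {g : V → V} {R : Finset (V × V)} {s : ExploreState V}

/-- Both kinds of rejection preserve the invariants: that of an edge with an explored source, which is
not recorded in `R`, and that of an edge whose source is neither explored nor in `X`. -/
theorem reject (hloop : ∀ v, ¬ G.Adj v v) (hs : ExplorationInv G X w g R s) {e : V × V}
    {l : List (V × V)} (hL : s.L = e :: l) {R' : Finset (V × V)}
    (h : e.1 ∈ s.A ∧ R' = R ∨ e.1 ∉ s.A ∧ e.1 ∉ X ∧ R' = insert e R) :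
    ExplorationInv G X w g R' (rejectEdge s e) := by
  have he : e ∈ s.L := by simp [hL]
  have hRR : ∀ r ∈ R', r ∈ R ∨ r = e ∧ e.1 ∉ s.A ∧ e.1 ∉ X := by
    intro r hr
    rcases h with ⟨-, rfl⟩ | ⟨h1, h2, rfl⟩
    · exact Or.inl hr
    · rcases Finset.mem_insert.1 hr with rfl | hr
      · exact Or.inr ⟨rfl, h1, h2⟩
      · exact Or.inl hr
  have huz : ∀ u ∈ X, u ∉ s.A → u ≠ e.1 := by
    rintro u hu huA rfl
    rcases h with ⟨h, -⟩ | ⟨-, h, -⟩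
    · exact huA h
    · exact h hu
  refine
    { root_mem := hs.root_mem
      root_fixed := hs.root_fixed
      map_mem := hs.map_mem
      adj := hs.adj
      reach := hs.reach
      list_adj := fun f hf => hs.list_adj f (List.mem_of_mem_filter hf)
      list_ne := fun f hf => hs.list_ne f (List.mem_of_mem_filter hf)
      list_target := fun f hf => hs.list_target f (List.mem_of_mem_filter hf)
      list_source := fun f hf => hs.list_source f (List.mem_of_mem_filter hf)
      edges_adj := fun f hf => hs.edges_adj f (Finset.mem_of_mem_filter f hf)
      edges_ne := fun f hf => hs.edges_ne f (Finset.mem_of_mem_filter f hf)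
      fifo := hs.fifo.filter _
      rejected_notMem := ?_, rejected_list := ?_, rejected_edges := ?_, pending_list := ?_,
      pending_edges := ?_ }
  all_goals simp only [rejectEdge, List.mem_filter, Finset.mem_filter, decide_eq_true_eq]
  · intro r hr
    rcases hRR r hr with hr | ⟨rfl, hr⟩
    · exact hs.rejected_notMem r hr
    · exact hr
  · intro r hr f hf
    rcases hRR r hr with hr | ⟨rfl, -⟩
    · exact hs.rejected_list r hr f hf.1
    · exact hf.2.1
  · intro r hr f hf
    rcases hRR r hr with hr | ⟨rfl, -⟩
    · exact hs.rejected_edges r hr f hf.1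
    · exact hf.2.1
  · intro u hu huA v hv huv hvA
    have hmem := hs.pending_list u hu huA v hv huv hvA
    refine ⟨hmem, huz u hu huA, ?_⟩
    -- by the order of the list, the edge `(u, v)` cannot come after the rejected edge if it ends at
    -- the source of the latter
    have hfifo := hs.fifo
    rw [hL] at hmem hfifo
    rcases List.mem_cons.1 hmem with rfl | hmem
    · rintro rfl
      exact hloop _ huv
    · exact (List.pairwise_cons.1 hfifo).1 _ hmem
  · intro u hu huA v hv huv hvA
    refine ⟨hs.pending_edges u hu huA v hv huv hvA, huz u hu huA, ?_⟩
    exact huz v hv hvA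

theorem subset_of_list_eq_nil (hX : StronglyConnected G X) (hw : w ∈ X)
    (hs : ExplorationInv G X w g R s) (hL : s.L = []) : X ⊆ s.A := by
  intro u hu
  have := hX.2 u hu w hw
  induction this using Relation.ReflTransGen.head_induction_on with
  | refl => exact hs.root_mem
  | @head u v huv _ ih =>
    by_contra huA
    have := hs.pending_list u huv.1 huA v huv.2.1 huv.2.2 (ih huv.2.1)
    simp [hL] at this

end ExplorationInv

variable [Fintype V] (o : LinearOrder V)

/-- The state after an iteration in which the first edge `e` of the list belongs to the tree. -/
def acceptEdge (s : ExploreState V) (e : V × V) : ExploreState V where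
  A := insert e.1 s.A
  L := s.L.filter (fun f => f.1 ≠ e.1) ++ edgesInto o s.F e.1
  F := s.F

variable (G) in
/-- The initial state of the exploration of the trees with root `w`. -/
def exploreFrom [DecidableRel G.Adj] (w : V) : ExploreState V where
  A := {w}
  L := edgesInto o (Finset.univ.filter (fun e => G.Adj e.1 e.2)) w
  F := Finset.univ.filter (fun e => G.Adj e.1 e.2 ∧ e.1 ≠ w)

variable {o}

theorem exploreStep_cons {a : SpanningTree G} {s : ExploreState V} {e : V × V} {l : List (V × V)}
    (hL : s.L = e :: l) :
    exploreStep o a s = if e ∈ a.edges then acceptEdge o s e else rejectEdge s e := by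
  unfold exploreStep
  rw [hL]
  simp only [acceptEdge, rejectEdge, hL]

theorem exploreStep_nil {a : SpanningTree G} {s : ExploreState V} (hL : s.L = []) :
    exploreStep o a s = s := by
  unfold exploreStep
  rw [hL]

theorem exploreMeasure_acceptEdge_lt {s : ExploreState V} {e : V × V} (he : e.1 ∉ s.A) :
    exploreMeasure (acceptEdge o s e) < exploreMeasure s := by
  refine add_lt_add_of_lt_of_le (Finset.card_lt_card ?_) (Finset.card_le_card ?_)
  · rw [Finset.compl_ssubset_compl]
    exact Finset.ssubset_insert he
  · refine Finset.image_subset_image fun f hf => ?_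
    simp only [acceptEdge, Finset.mem_union, List.mem_toFinset, List.mem_append,
      mem_edgesInto] at hf ⊢
    rcases hf with (hf | hf) | hf
    · exact Or.inl (List.mem_of_mem_filter hf)
    · exact Or.inr hf.1
    · exact Or.inr hf

theorem exploreMeasure_rejectEdge_lt {s : ExploreState V} {e : V × V} (he : e ∈ s.L) :
    exploreMeasure (rejectEdge s e) < exploreMeasure s := by
  refine add_lt_add_of_le_of_lt le_rfl (Finset.card_lt_card ⟨?_, fun h => ?_⟩)
  · refine Finset.image_subset_image fun f hf => ?_
    simp only [rejectEdge, Finset.mem_union, List.mem_toFinset] at hf ⊢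
    rcases hf with hf | hf
    · exact Or.inl (List.mem_of_mem_filter hf)
    · exact Or.inr (Finset.mem_of_mem_filter f hf)
  · have := h (Finset.mem_image_of_mem Prod.fst
      (Finset.mem_union_left s.F (List.mem_toFinset.2 he)))
    simp only [rejectEdge, Finset.mem_image, Finset.mem_union, List.mem_toFinset, List.mem_filter,
      Finset.mem_filter, decide_eq_true_eq] at this
    obtain ⟨f, hf, hfe⟩ := this
    rcases hf with hf | hf
    · exact hf.2.1 hfe
    · exact hf.2.1 hfe

/-- A vertex that is the source of no edge in the list or in `F` is never explored. -/
theorem notMem_iterate_exploreStep {a : SpanningTree G} {z : V} (n : ℕ) {s : ExploreState V}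
    (hA : z ∉ s.A) (hL : ∀ f ∈ s.L, f.1 ≠ z) (hF : ∀ f ∈ s.F, f.1 ≠ z) :
    z ∉ ((exploreStep o a)^[n] s).A := by
  induction n generalizing s with
  | zero => exact hA
  | succ n ih =>
    rw [Function.iterate_succ_apply]
    rcases hs : s.L with _ | ⟨e, l⟩
    · rw [exploreStep_nil hs]
      exact ih hA hL hF
    · rw [exploreStep_cons hs]
      split_ifs
      · refine ih ?_ ?_ hF
        · simp only [acceptEdge, Finset.mem_insert, not_or]
          exact ⟨(hL e (by simp [hs])).symm, hA⟩
        · intro f hf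
          simp only [acceptEdge, List.mem_append, mem_edgesInto] at hf
          rcases hf with hf | hf
          · exact hL f (List.mem_of_mem_filter hf)
          · exact hF f hf.1
      · refine ih hA (fun f hf => hL f ?_) (fun f hf => hF f ?_)
        · exact List.mem_of_mem_filter hf
        · exact Finset.mem_of_mem_filter f hf

namespace ExplorationInv

variable {X : Finset V} {w : V} {g : V → V} {R : Finset (V × V)} {s : ExploreState V}

theorem init [DecidableRel G.Adj] (hloop : ∀ v, ¬ G.Adj v v) (w : V) (X : Finset V) :
    ExplorationInv G X w id ∅ (exploreFrom G o w) where
  root_mem := by simp [exploreFrom]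
  root_fixed := rfl
  map_mem v hv := hv
  adj v hv h := absurd (by simpa [exploreFrom] using hv) h
  reach v hv := ⟨0, by simpa [exploreFrom] using hv⟩
  list_adj f hf := by
    simp only [exploreFrom, mem_edgesInto, Finset.mem_filter] at hf
    exact hf.1.2
  list_ne f hf h := by
    simp only [exploreFrom, mem_edgesInto, Finset.mem_filter] at hf
    have := hf.1.2
    rw [h, hf.2] at this
    exact hloop _ this
  list_target f hf := by
    simp only [exploreFrom, mem_edgesInto] at hf
    simp [exploreFrom, hf.2]
  list_source f hf h := by
    simp only [exploreFrom, mem_edgesInto, Finset.mem_filter] at hf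
    intro hg
    have := hf.1.2
    rw [← hg] at this
    exact hloop _ this
  edges_adj f hf := by
    simp only [exploreFrom, Finset.mem_filter] at hf
    exact hf.2.1
  edges_ne f hf := by
    simp only [exploreFrom, Finset.mem_filter] at hf
    exact hf.2.2
  fifo := by
    refine List.pairwise_of_forall_mem_list fun e he f hf h => ?_
    simp only [exploreFrom, mem_edgesInto, Finset.mem_filter] at he hf
    have := he.1.2
    rw [he.2, ← h, hf.2] at this
    exact hloop _ this
  rejected_notMem := by simp
  rejected_list := by simp
  rejected_edges := by simp
  pending_list u _ _ v _ huv hv := by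
    simp only [exploreFrom, Finset.mem_singleton] at hv
    subst hv
    simpa [exploreFrom, mem_edgesInto] using huv
  pending_edges u _ hu v _ huv _ := by
    simp only [exploreFrom, Finset.mem_singleton] at hu
    simp [exploreFrom, huv, hu]

theorem accept (hloop : ∀ v, ¬ G.Adj v v) (hs : ExplorationInv G X w g R s) {z p : V}
    (he : (z, p) ∈ s.L) (hz : z ∉ s.A) :
    ExplorationInv G X w (Function.update g z p) R (acceptEdge o s (z, p)) := by
  have hne : ∀ v ∈ s.A, v ≠ z := fun v hv h => hz (h ▸ hv)
  have hp : p ∈ s.A := hs.list_target _ he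
  have hreach : ∀ v ∈ s.A, ∃ k : ℕ, (Function.update g z p)^[k] v = w := by
    intro v hv
    obtain ⟨k, hk⟩ := hs.reach v hv
    refine ⟨k, ?_⟩
    induction k generalizing v with
    | zero => exact hk
    | succ k ih =>
      rw [Function.iterate_succ_apply, Function.update_of_ne (hne v hv)]
      exact ih _ (hs.map_mem v hv) hk
  refine
    { root_mem := Finset.mem_insert_of_mem hs.root_mem
      root_fixed := by rw [Function.update_of_ne (hne _ hs.root_mem), hs.root_fixed]
      map_mem := ?_, adj := ?_, reach := ?_, list_adj := ?_, list_ne := ?_, list_target := ?_,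
      list_source := ?_
      edges_adj := hs.edges_adj
      edges_ne := hs.edges_ne
      fifo := ?_, rejected_notMem := ?_, rejected_list := ?_
      rejected_edges := hs.rejected_edges
      pending_list := ?_, pending_edges := ?_ }
  all_goals simp only [acceptEdge, Finset.mem_insert, List.mem_append, mem_edgesInto,
    List.mem_filter, decide_eq_true_eq]
  · rintro v (rfl | hv)
    · simp [hp]
    · rw [Function.update_of_ne (hne v hv)]
      exact Or.inr (hs.map_mem v hv)
  · rintro v (rfl | hv) hvw
    · simpa using hs.list_adj _ he
    · rw [Function.update_of_ne (hne v hv)]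
      exact hs.adj v hv hvw
  · rintro v (rfl | hv)
    · obtain ⟨k, hk⟩ := hreach p hp
      exact ⟨k + 1, by simpa using hk⟩
    · exact hreach v hv
  · rintro f (hf | hf)
    · exact hs.list_adj f hf.1
    · exact hs.edges_adj f hf.1
  · rintro f (hf | hf)
    · exact hs.list_ne f hf.1
    · exact hs.edges_ne f hf.1
  · rintro f (hf | hf)
    · exact Or.inr (hs.list_target f hf.1)
    · exact Or.inl hf.2
  · rintro f (hf | hf) hfA
    · rw [Function.update_of_ne hf.2]
      exact hs.list_source f hf.1 (hfA.resolve_left hf.2)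
    · have hfz : f.1 ≠ z := by
        intro h
        have := hs.edges_adj f hf.1
        rw [h, hf.2] at this
        exact hloop z this
      rw [Function.update_of_ne hfz, hf.2]
      exact hne _ (hs.map_mem _ (hfA.resolve_left hfz))
  · refine List.pairwise_append.2 ⟨hs.fifo.filter _, ?_, ?_⟩
    · refine List.pairwise_of_forall_mem_list fun e he f hf h => ?_
      simp only [mem_edgesInto] at he hf
      have := hs.edges_adj e he.1
      rw [he.2, ← h, hf.2] at this
      exact hloop z this
    · intro e he f hf h
      simp only [mem_edgesInto, List.mem_filter, decide_eq_true_eq] at he hf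
      exact he.2 (h ▸ hf.2)
  · intro r hr
    refine ⟨?_, (hs.rejected_notMem r hr).2⟩
    rintro (h | h)
    · exact hs.rejected_list r hr _ he h.symm
    · exact (hs.rejected_notMem r hr).1 h
  · rintro r hr f (hf | hf)
    · exact hs.rejected_list r hr f hf.1
    · exact hs.rejected_edges r hr f hf.1
  · rintro u hu huA v hv huv hvA
    rw [not_or] at huA
    by_cases hvz : v = z
    · subst hvz
      exact Or.inr ⟨hs.pending_edges u hu huA.2 v hv huv hz, rfl⟩
    · exact Or.inl ⟨hs.pending_list u hu huA.2 v hv huv (hvA.resolve_left hvz), huA.1⟩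
  · rintro u hu huA v hv huv hvA
    rw [not_or] at huA hvA
    exact hs.pending_edges u hu huA.2 v hv huv hvA.2

end ExplorationInv

open Classical in
theorem card_explored_eq_forestCount_of_nil {X : Finset V} {w : V}
    (hX : StronglyConnected G X) (hw : w ∈ X) (n : ℕ) (s : ExploreState V) (g : V → V)
    (R : Finset (V × V)) (hs : ExplorationInv G X w g R s) (hL : s.L = []) :
    (Finset.univ.filter fun a : SpanningTree G => a.root = w ∧ ((∀ v ∈ s.A, a.parent v = g v) ∧
      ∀ r ∈ R, a.parent r.1 ≠ r.2) ∧ X ⊆ ((exploreStep o a)^[n] s).A).card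
      = forestCount G (s.A ∪ X : Set V) R := by
  have hXA := hs.subset_of_list_eq_nil hX hw hL
  have hfix : ∀ a : SpanningTree G, (exploreStep o a)^[n] s = s := fun a =>
    Function.iterate_fixed (exploreStep_nil hL) n
  have hZ : (s.A ∪ X : Set V) = (s.A : Set V) := Set.union_eq_left.2 (by exact_mod_cast hXA)
  simp only [hfix, hXA, and_true]
  have h1 := card_trees_eq (G := G) w fun f => (∀ v ∈ s.A, f v = g v) ∧ ∀ r ∈ R, f r.1 ≠ r.2
  have h2 := card_forests_extending (G := G) (Z' := {w}) (Z := s.A) (g := g)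
    (by simpa using hs.root_mem) (by rintro v rfl; exact hs.root_fixed) hs.map_mem
    (fun v hv hv' => hs.adj v hv hv') hs.reach R (fun r hr => (hs.rejected_notMem r hr).1)
  rw [hZ, ← h2]
  convert h1
  exact Finset.mem_coe

open Classical in
/-- Among the trees whose exploration passes through the state `s`, those for which all of `X` gets
explored are as many as the forests rooted at `s.A ∪ X` that contain no rejected edge. Indeed, each
edge examined either has its source in `X` and must be accepted, which changes neither count, or is
accepted or rejected, and both counts split in the same way. -/
theorem card_explored_eq_forestCount (hloop : ∀ v, ¬ G.Adj v v) {X : Finset V} {w : V}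
    (hX : StronglyConnected G X) (hw : w ∈ X) (n : ℕ) (s : ExploreState V) (g : V → V)
    (R : Finset (V × V)) (hs : ExplorationInv G X w g R s) (hn : exploreMeasure s ≤ n) :
    (Finset.univ.filter fun a : SpanningTree G => a.root = w ∧ ((∀ v ∈ s.A, a.parent v = g v) ∧
      ∀ r ∈ R, a.parent r.1 ≠ r.2) ∧ X ⊆ ((exploreStep o a)^[n] s).A).card
      = forestCount G (s.A ∪ X : Set V) R := by
  induction n generalizing s g R with
  | zero =>
    refine card_explored_eq_forestCount_of_nil hX hw 0 s g R hs ?_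
    by_contra hL
    obtain ⟨e, l, hL⟩ := List.exists_cons_of_ne_nil hL
    have := exploreMeasure_rejectEdge_lt (s := s) (e := e) (by simp [hL])
    omega
  | succ n ih =>
    rcases hL : s.L with _ | ⟨⟨z, p⟩, l⟩
    · exact card_explored_eq_forestCount_of_nil hX hw _ s g R hs hL
    have he : (z, p) ∈ s.L := by simp [hL]
    have hzw : z ≠ w := hs.list_ne _ he
    have hmem : ∀ a : SpanningTree G, a.root = w → ((z, p) ∈ a.edges ↔ a.parent z = p) := by
      rintro a rfl
      simp [a.mem_edges_iff, hzw]
    have hstep : ∀ a : SpanningTree G, (exploreStep o a)^[n + 1] s = (exploreStep o a)^[n]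
        (if (z, p) ∈ a.edges then acceptEdge o s (z, p) else rejectEdge s (z, p)) := fun a => by
      rw [Function.iterate_succ_apply, exploreStep_cons hL]
    have hnr : exploreMeasure (rejectEdge s (z, p)) ≤ n := by
      have := exploreMeasure_rejectEdge_lt he
      omega
    by_cases hzA : z ∈ s.A
    · rw [← show (rejectEdge s (z, p)).A = s.A from rfl,
        ← ih _ g R (hs.reject hloop hL (Or.inl ⟨hzA, rfl⟩)) hnr]
      congr 1
      refine Finset.filter_congr fun a _ => ?_
      refine and_congr_right fun ha => and_congr_right fun ha' => ?_
      rw [hstep, if_neg]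
      rw [hmem a ha, ha'.1 z hzA]
      exact hs.list_source _ he hzA
    have hna : exploreMeasure (acceptEdge o s (z, p)) ≤ n := by
      have := exploreMeasure_acceptEdge_lt (o := o) (s := s) (e := (z, p)) hzA
      omega
    have hne : ∀ v ∈ s.A, v ≠ z := fun v hv h => hzA (h ▸ hv)
    have hacc := ih _ _ R (hs.accept (o := o) hloop he hzA) hna
    have hfilter : ∀ a : SpanningTree G, (a.root = w ∧
        ((∀ v ∈ (acceptEdge o s (z, p)).A, a.parent v = Function.update g z p v) ∧
          ∀ r ∈ R, a.parent r.1 ≠ r.2) ∧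
          X ⊆ ((exploreStep o a)^[n] (acceptEdge o s (z, p))).A) ↔
        (a.root = w ∧ ((∀ v ∈ s.A, a.parent v = g v) ∧ ∀ r ∈ R, a.parent r.1 ≠ r.2) ∧
          X ⊆ ((exploreStep o a)^[n + 1] s).A) ∧ a.parent z = p := by
      intro a
      have hA : (∀ v ∈ (acceptEdge o s (z, p)).A, a.parent v = Function.update g z p v)
          ↔ a.parent z = p ∧ ∀ v ∈ s.A, a.parent v = g v := by
        simp only [acceptEdge, Finset.forall_mem_insert, Function.update_self]
        refine and_congr_right fun _ => forall₂_congr fun v hv => ?_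
        rw [Function.update_of_ne (hne v hv)]
      rw [hA]
      by_cases ha : a.root = w
      · by_cases hp : a.parent z = p
        · rw [hstep, if_pos ((hmem a ha).2 hp)]
          simp [ha, hp]
        · simp [hp]
      · simp [ha]
    simp only [hfilter] at hacc
    by_cases hzX : z ∈ X
    · have hZ : ((acceptEdge o s (z, p)).A ∪ X : Set V) = (s.A : Set V) ∪ X := by
        simp only [acceptEdge, Finset.coe_insert, Set.insert_union]
        exact Set.insert_eq_of_mem (Or.inr hzX)
      rw [← hZ, ← hacc]
      congr 1
      refine Finset.filter_congr fun a _ => (and_iff_left_of_imp ?_).symm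
      -- if the edge is rejected, then `z` stays unexplored
      rintro ⟨ha, -, hXA⟩
      by_contra hp
      rw [hstep, if_neg (fun h => hp ((hmem a ha).1 h))] at hXA
      refine notMem_iterate_exploreStep (s := rejectEdge s (z, p)) n hzA ?_ ?_ (hXA hzX)
      · intro f hf
        simp only [rejectEdge, List.mem_filter, decide_eq_true_eq] at hf
        exact hf.2.1
      · intro f hf
        simp only [rejectEdge, Finset.mem_filter] at hf
        exact hf.2.1
    · have hZ : ((acceptEdge o s (z, p)).A ∪ X : Set V) = insert z (s.A ∪ X : Set V) := by
        simp only [acceptEdge, Finset.coe_insert, Set.insert_union]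
      have hrej := ih _ _ _ (hs.reject hloop hL (Or.inr ⟨hzA, hzX, rfl⟩)) hnr
      rw [forestCount_eq_add (G := G) (z := z) (p := p) (by simp [hzA, hzX])
        (Or.inl (hs.list_target _ he)) (hs.list_adj _ he) R, ← hZ, ← hacc,
        ← show (rejectEdge s (z, p)).A = s.A from rfl, ← hrej,
        ← Finset.card_filter_add_card_filter_not (fun a : SpanningTree G => a.parent z = p),
        Finset.filter_filter, Finset.filter_filter]
      · congr 2
        refine Finset.filter_congr fun a _ => ?_
        simp only [Finset.forall_mem_insert]
        by_cases ha : a.root = w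
        · by_cases hp : a.parent z = p
          · simp [hp]
          · rw [hstep, if_neg (fun h => hp ((hmem a ha).1 h))]
            simp only [rejectEdge]
            tauto
        · simp [ha]
      · intro r hr
        simp only [Set.mem_insert_iff, Set.mem_union, Finset.mem_coe, not_or]
        exact ⟨fun h => hs.rejected_list r hr _ he h.symm, hs.rejected_notMem r hr⟩

open Classical in
theorem card_subset_phi [DecidableRel G.Adj] (hloop : ∀ v, ¬ G.Adj v v) {X : Finset V} {w : V}
    (hX : StronglyConnected G X) (hw : w ∈ X) :
    (Finset.univ.filter fun a : SpanningTree G => a.root = w ∧ X ⊆ phi o a).card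
      = forestCount G X ∅ := by
  have hn : exploreMeasure (exploreFrom G o w) ≤ 2 * Fintype.card V := by
    have h1 := Finset.card_le_univ (exploreFrom G o w).Aᶜ
    have h2 := Finset.card_le_univ
      (((exploreFrom G o w).L.toFinset ∪ (exploreFrom G o w).F).image Prod.fst)
    unfold exploreMeasure
    omega
  have key := card_explored_eq_forestCount (o := o) hloop hX hw _ _ _ _
    (ExplorationInv.init (o := o) hloop w X) hn
  have hZ : ((exploreFrom G o w).A ∪ X : Set V) = X :=
    Set.union_eq_right.2 (by simpa [exploreFrom] using hw)
  rw [← hZ, ← key]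
  congr 1
  refine Finset.filter_congr fun a _ => and_congr_right fun ha => ?_
  have hinit : exploreInit o a = exploreFrom G o w := by
    rw [← ha]
    rfl
  rw [phi, exploreFinal, hinit]
  refine (and_iff_right ⟨?_, by simp⟩).symm
  simp [exploreFrom, ← ha, a.parent_root]

end Explore

/-! ### Multiplicities -/

section Multiplicities

variable {V : Type*} {G : Digraph V}

theorem ReachIn.mono {X Y : Finset V} (h : X ⊆ Y) {u v : V} (huv : ReachIn G X u v) :
    ReachIn G Y u v :=
  Relation.ReflTransGen.mono (fun _ _ hs => ⟨h hs.1, h hs.2.1, hs.2.2⟩) _ _ huv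

/-- The paths witnessing that a vertex belongs to the strongly connected component `C` of `r` do not
leave `C`. -/
theorem stronglyConnected_component (Y C : Finset V) (r : V) (hr : r ∈ Y)
    (hC : ∀ u, u ∈ C ↔ u ∈ Y ∧ ReachIn G Y r u ∧ ReachIn G Y u r) : StronglyConnected G C := by
  have hrC : r ∈ C := (hC r).2 ⟨hr, .refl, .refl⟩
  have hto : ∀ u, ReachIn G Y u r → ReachIn G Y r u → ReachIn G C u r := by
    intro u hur
    induction hur using Relation.ReflTransGen.head_induction_on with
    | refl => exact fun _ => .refl
    | @head u v huv hvr ih =>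
      intro hru
      have hrv : ReachIn G Y r v := hru.tail huv
      exact Relation.ReflTransGen.head ⟨(hC u).2 ⟨huv.1, hru, hvr.head huv⟩,
        (hC v).2 ⟨huv.2.1, hrv, hvr⟩, huv.2.2⟩ (ih hrv)
  have hfrom : ∀ u, ReachIn G Y r u → ReachIn G Y u r → ReachIn G C r u := by
    intro u hru
    induction hru with
    | refl => exact fun _ => .refl
    | @tail v u hrv hvu ih =>
      intro hur
      have hvr : ReachIn G Y v r := hur.head hvu
      exact Relation.ReflTransGen.tail (ih hvr) ⟨(hC v).2 ⟨hvu.1, hrv, hvr⟩,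
        (hC u).2 ⟨hvu.2.1, hrv.tail hvu, hur⟩, hvu.2.2⟩
  refine ⟨⟨r, hrC⟩, fun u hu v hv => ?_⟩
  have hu := (hC u).1 hu
  have hv := (hC v).1 hv
  exact (hto u hu.2.2 hu.2.1).trans (hfrom v hv.2.1 hv.2.2)

variable [Fintype V] [DecidableEq V] [DecidableRel G.Adj]

theorem root_mem_phi (o : LinearOrder V) (a : SpanningTree G) : a.root ∈ phi o a := by
  have key : ∀ (n : ℕ) (s : ExploreState V), a.root ∈ s.A → a.root ∈ ((exploreStep o a)^[n] s).A := by
    intro n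
    induction n with
    | zero => exact fun _ h => h
    | succ n ih =>
      intro s hs
      rw [Function.iterate_succ_apply]
      apply ih
      rcases hL : s.L with _ | ⟨e, l⟩
      · rwa [exploreStep_nil hL]
      · rw [exploreStep_cons hL]
        split_ifs
        · exact Finset.mem_insert_of_mem hs
        · exact hs
  exact key _ _ (by simp [exploreInit])

theorem mem_psi {o : LinearOrder V} {a : SpanningTree G} {u : V} :
    u ∈ psi o a ↔ u ∈ phi o a ∧ ReachIn G (phi o a) a.root u ∧ ReachIn G (phi o a) u a.root := by
  simp [psi]

theorem root_mem_psi (o : LinearOrder V) (a : SpanningTree G) : a.root ∈ psi o a :=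
  mem_psi.2 ⟨root_mem_phi o a, .refl, .refl⟩

theorem stronglyConnected_psi (o : LinearOrder V) (a : SpanningTree G) :
    StronglyConnected G (psi o a) :=
  stronglyConnected_component (phi o a) _ a.root (root_mem_phi o a) fun _ => mem_psi

theorem subset_psi_iff {o : LinearOrder V} {a : SpanningTree G} {X : Finset V}
    (hX : StronglyConnected G X) (hr : a.root ∈ X) : X ⊆ psi o a ↔ X ⊆ phi o a := by
  constructor
  · exact fun h u hu => (mem_psi.1 (h hu)).1
  · exact fun h u hu => mem_psi.2 ⟨h hu, (hX.2 _ hr _ hu).mono h, (hX.2 _ hu _ hr).mono h⟩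

open Classical in
theorem card_subset_psi (hloop : ∀ v, ¬ G.Adj v v) (o : LinearOrder V) {X : Finset V} {w : V}
    (hX : StronglyConnected G X) (hw : w ∈ X) :
    (Finset.univ.filter fun a : SpanningTree G => a.root = w ∧ X ⊆ psi o a).card
      = forestCount G X ∅ := by
  rw [← card_subset_phi (o := o) hloop hX hw]
  congr 1
  exact Finset.filter_congr fun a _ => and_congr_right fun ha => subset_psi_iff hX (ha ▸ hw)

open Classical in
/-- The numbers `m(W, w)` for the strongly connected `W ⊇ X` add up to a number that depends
neither on `w ∈ X` nor on the order. -/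
theorem sum_mult_eq_forestCount (hloop : ∀ v, ¬ G.Adj v v) (o : LinearOrder V) {X : Finset V}
    {w : V} (hX : StronglyConnected G X) (hw : w ∈ X) :
    ∑ W ∈ Finset.univ.filter (fun W => StronglyConnected G W ∧ X ⊆ W), mult G o W w
      = forestCount G X ∅ := by
  rw [← card_subset_psi hloop o hX hw]
  rw [Finset.card_eq_sum_card_fiberwise (f := psi o)
    (t := Finset.univ.filter (fun W => StronglyConnected G W ∧ X ⊆ W))]
  · refine Finset.sum_congr rfl fun W hW => ?_
    rw [Finset.filter_filter, mult]
    congr 1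
    refine Finset.filter_congr fun a _ => ?_
    constructor
    · rintro ⟨h1, rfl⟩
      exact ⟨⟨h1, (Finset.mem_filter.1 hW).2.2⟩, rfl⟩
    · rintro ⟨⟨h1, -⟩, h2⟩
      exact ⟨h1, h2⟩
  · intro a ha
    have ha := (Finset.mem_filter.1 (Finset.mem_coe.1 ha)).2
    exact Finset.mem_coe.2 (Finset.mem_filter.2
      ⟨Finset.mem_univ _, stronglyConnected_psi o a, ha.2⟩)

/-- Downward induction on `X`, by `sum_mult_eq_forestCount`. -/
theorem mult_eq_mult (hloop : ∀ v, ¬ G.Adj v v) {X : Finset V} (hX : StronglyConnected G X)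
    (o o' : LinearOrder V) {w w' : V} (hw : w ∈ X) (hw' : w' ∈ X) :
    mult G o X w = mult G o' X w' := by
  classical
  induction X using WellFoundedGT.induction with
  | ind X ih =>
    have h := (sum_mult_eq_forestCount hloop o hX hw).trans
      (sum_mult_eq_forestCount hloop o' hX hw').symm
    have hmem : X ∈ Finset.univ.filter (fun W => StronglyConnected G W ∧ X ⊆ W) := by
      simp [hX]
    rw [← Finset.add_sum_erase _ _ hmem, ← Finset.add_sum_erase _ _ hmem] at h
    have hrest : ∀ W ∈ (Finset.univ.filter (fun W => StronglyConnected G W ∧ X ⊆ W)).erase X,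
        mult G o W w = mult G o' W w' := by
      intro W hW
      obtain ⟨hne, hW⟩ := Finset.mem_erase.1 hW
      obtain ⟨hWs, hXW⟩ := (Finset.mem_filter.1 hW).2
      exact ih W (hXW.ssubset_of_ne hne.symm) hWs (hXW hw) (hXW hw')
    rw [Finset.sum_congr rfl hrest] at h
    exact Nat.add_right_cancel h

end Multiplicities

/-! ### Powers of matrices as sums over walks -/

section Walks

variable {V R : Type*} [Fintype V] [CommSemiring R]

/-- The sum over the walks `v₀, v₁, …, vₙ` that start at `v₀ = r`, listed in this order, of
`M v₀ v₁ * ⋯ * M vₙ₋₁ vₙ * F [v₀, …, vₙ]`. -/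
def walkSum (M : Matrix V V R) : ℕ → V → (List V → R) → R
  | 0, r, F => F [r]
  | n + 1, r, F => ∑ u, M r u * walkSum M n u fun l => F (r :: l)

variable {M : Matrix V V R}

theorem walkSum_congr {n : ℕ} {r : V} {F F' : List V → R}
    (h : ∀ l : List V, (r :: l).IsChain (fun u v => M u v ≠ 0) → F (r :: l) = F' (r :: l)) :
    walkSum M n r F = walkSum M n r F' := by
  induction n generalizing r F F' with
  | zero => exact h [] (by simp)
  | succ n ih =>
    refine Finset.sum_congr rfl fun u _ => ?_
    by_cases hu : M r u = 0
    · simp [hu]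
    · congr 1
      exact ih fun l hl => h _ (List.isChain_cons_cons.2 ⟨hu, hl⟩)

theorem walkSum_sum {ι : Type*} (s : Finset ι) (n : ℕ) (r : V) (F : ι → List V → R) :
    walkSum M n r (fun l => ∑ i ∈ s, F i l) = ∑ i ∈ s, walkSum M n r (F i) := by
  induction n generalizing r F with
  | zero => rfl
  | succ n ih =>
    simp only [walkSum, ih, Finset.mul_sum]
    exact Finset.sum_comm

theorem walkSum_zero (n : ℕ) (r : V) : walkSum M n r (fun _ => 0) = 0 := by
  simpa using walkSum_sum (M := M) (∅ : Finset Unit) n r fun _ _ => 0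

variable [DecidableEq V]

theorem submatrix_pow_apply (W : Finset V) (n : ℕ) (i j : W) :
    ((M.submatrix Subtype.val Subtype.val : Matrix W W R) ^ n) i j = walkSum M n i
      (fun l => if (∀ v ∈ l, v ∈ W) ∧ l.getLast? = some (j : V) then 1 else 0) := by
  induction n generalizing i with
  | zero =>
    have h : (∀ v ∈ [(i : V)], v ∈ W) ∧ [(i : V)].getLast? = some (j : V) ↔ i = j :=
      ⟨fun h => Subtype.ext (by simpa using h.2), fun h => ⟨by simp, by simp [h]⟩⟩
    simp only [walkSum, h, pow_zero, Matrix.one_apply]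
  | succ n ih =>
    rw [pow_succ', Matrix.mul_apply]
    have h1 : ∀ u : W, walkSum M n u
        (fun l => if (∀ v ∈ l, v ∈ W) ∧ l.getLast? = some (j : V) then 1 else 0)
        = walkSum M n u
        (fun l => if (∀ v ∈ (i : V) :: l, v ∈ W) ∧ ((i : V) :: l).getLast? = some (j : V)
          then 1 else 0) := fun u => walkSum_congr fun l _ => by simp
    simp only [ih, h1, walkSum, Matrix.submatrix_apply]
    rw [Finset.sum_coe_sort W fun u => M i u * walkSum M n u
        (fun l => if (∀ v ∈ (i : V) :: l, v ∈ W) ∧ ((i : V) :: l).getLast? = some (j : V)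
          then 1 else 0)]
    refine Finset.sum_subset (Finset.subset_univ _) fun u _ hu => ?_
    rw [walkSum_congr (F' := fun _ => 0), walkSum_zero, mul_zero]
    intro l _
    simp [hu]

end Walks

/-! ### Lifting walks to the tree graph -/

section Lift

variable {V : Type*} [DecidableEq V] {G : Digraph V}

/-- The effect on parent functions of moving the root along a walk. -/
def liftWalk : (V → V) → List V → V → V
  | f, [] => f
  | f, [_] => f
  | f, r :: u :: l => liftWalk (moveRoot f r u) (u :: l)

theorem liftWalk_of_notMem {f : V → V} {l : List V} {v : V} (hv : v ∉ l) :
    liftWalk f l v = f v := by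
  induction l generalizing f with
  | nil => rfl
  | cons r l ih =>
    rcases l with _ | ⟨u, l⟩
    · rfl
    · have hvr : v ≠ r := fun h => hv (by simp [h])
      have hvu : v ≠ u := fun h => hv (by simp [h])
      rw [liftWalk, ih fun h => hv (List.mem_cons_of_mem _ h)]
      simp [moveRoot, hvr, hvu]

/-- On the vertices of the walk, the result does not depend on the tree at the start. -/
theorem liftWalk_eq_liftWalk {f f' : V → V} {r : V} {l : List V} (hf : f r = f' r) {v : V}
    (hv : v ∈ r :: l) : liftWalk f (r :: l) v = liftWalk f' (r :: l) v := by
  induction l generalizing f f' r with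
  | nil =>
    obtain rfl : v = r := by simpa using hv
    exact hf
  | cons u l ih =>
    by_cases hvl : v ∈ u :: l
    · exact ih (by simp [moveRoot]) hvl
    · obtain rfl : v = r := (List.mem_cons.1 hv).resolve_right hvl
      rw [liftWalk, liftWalk, liftWalk_of_notMem hvl, liftWalk_of_notMem hvl]
      have : v ≠ u := fun h => hvl (by simp [h])
      simp [moveRoot, this]

/-- On the vertices of a walk, the parent of a vertex at the end of the walk is the target of the last
exit from this vertex; this is a tree rooted at the end `w` of the walk. -/
theorem liftWalk_isTree {f : V → V} {r w : V} {l : List V} (hf : f r = r)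
    (hl : (r :: l).IsChain (fun u v => u = v ∨ G.Adj u v)) (hw : (r :: l).getLast? = some w) :
    liftWalk f (r :: l) w = w ∧ ∀ v ∈ r :: l, liftWalk f (r :: l) v ∈ r :: l ∧
      (v ≠ w → G.Adj v (liftWalk f (r :: l) v)) ∧ ∃ k : ℕ, (liftWalk f (r :: l))^[k] v = w := by
  induction l generalizing f r with
  | nil =>
    obtain rfl : r = w := by simpa using hw
    refine ⟨hf, fun v hv => ?_⟩
    obtain rfl : v = r := by simpa using hv
    exact ⟨by simp [liftWalk, hf], fun h => absurd rfl h, 0, rfl⟩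
  | cons u l ih =>
    obtain ⟨hru, hl⟩ := List.isChain_cons_cons.1 hl
    have hw : (u :: l).getLast? = some w := by simpa using hw
    obtain ⟨h1, h2⟩ := ih (f := moveRoot f r u) (by simp [moveRoot]) hl hw
    rw [liftWalk]
    refine ⟨h1, fun v hv => ?_⟩
    by_cases hvl : v ∈ u :: l
    · obtain ⟨h3, h4⟩ := h2 v hvl
      exact ⟨List.mem_cons_of_mem _ h3, h4⟩
    · obtain rfl : v = r := (List.mem_cons.1 hv).resolve_right hvl
      have hvu : v ≠ u := fun h => hvl (by simp [h])
      have hg : liftWalk (moveRoot f v u) (u :: l) v = u := by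
        rw [liftWalk_of_notMem hvl]
        simp [moveRoot, hvu]
      obtain ⟨-, -, k, hk⟩ := h2 u (by simp)
      refine ⟨by simp [hg], fun _ => hg.symm ▸ hru.resolve_left hvu, k + 1, ?_⟩
      rw [Function.iterate_succ_apply, hg, hk]

theorem reachIn_of_walk {X : Finset V} {r w : V} {l : List V} (hX : ∀ v ∈ r :: l, v ∈ X)
    (hl : (r :: l).IsChain (fun u v => u = v ∨ G.Adj u v)) (hw : (r :: l).getLast? = some w)
    {v : V} (hv : v ∈ r :: l) : ReachIn G X r v ∧ ReachIn G X v w := by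
  induction l generalizing r v with
  | nil =>
    obtain rfl : r = w := by simpa using hw
    obtain rfl : v = r := by simpa using hv
    exact ⟨.refl, .refl⟩
  | cons u l ih =>
    obtain ⟨hru, hl⟩ := List.isChain_cons_cons.1 hl
    have hw : (u :: l).getLast? = some w := by simpa using hw
    have ih := fun {v} => ih (v := v) (fun v hv => hX v (List.mem_cons_of_mem _ hv)) hl hw
    have hru : ReachIn G X r u := by
      rcases hru with rfl | h
      · exact .refl
      · exact .single ⟨hX r (by simp), hX u (by simp), h⟩
    by_cases hvl : v ∈ u :: l
    · exact ⟨hru.trans (ih hvl).1, (ih hvl).2⟩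
    · obtain rfl : v = r := (List.mem_cons.1 hv).resolve_right hvl
      exact ⟨.refl, hru.trans (ih (by simp)).2⟩

theorem stronglyConnected_of_closed_walk {w : V} {l : List V}
    (hl : (w :: l).IsChain (fun u v => u = v ∨ G.Adj u v)) (hw : (w :: l).getLast? = some w) :
    StronglyConnected G (w :: l).toFinset := by
  refine ⟨⟨w, by simp⟩, fun u hu v hv => ?_⟩
  have key := fun {v} => reachIn_of_walk (G := G) (X := (w :: l).toFinset) (v := v)
    (fun v hv => List.mem_toFinset.2 hv) hl hw
  exact (key (List.mem_toFinset.1 hu)).2.trans (key (List.mem_toFinset.1 hv)).1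

variable [Fintype V]

open Classical in
/-- The lift of a closed walk that starts at the tree `a` is closed if and only if `a` agrees on the
vertices of the walk with the tree of last exits. -/
theorem card_closed_lifts {w : V} {l : List V}
    (hl : (w :: l).IsChain (fun u v => u = v ∨ G.Adj u v)) (hw : (w :: l).getLast? = some w) :
    (Finset.univ.filter fun a : SpanningTree G =>
      a.root = w ∧ liftWalk a.parent (w :: l) = a.parent).card
      = forestCount G (w :: l).toFinset ∅ := by
  obtain ⟨h1, h2⟩ := liftWalk_isTree (f := id) rfl hl hw
  have h3 := card_trees_eq (G := G) w fun f =>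
    (∀ v ∈ ((w :: l).toFinset : Set V), f v = liftWalk id (w :: l) v) ∧
      ∀ r ∈ (∅ : Finset (V × V)), f r.1 ≠ r.2
  have h4 := card_forests_extending (G := G) (Z' := {w}) (Z := (w :: l).toFinset)
    (g := liftWalk id (w :: l)) (by simp) (by rintro v rfl; exact h1)
    (fun v hv => by
      simpa only [Finset.mem_coe, List.mem_toFinset] using (h2 v (by simpa using hv)).1)
    (fun v hv hv' => (h2 v (by simpa using hv)).2.1 hv')
    (fun v hv => (h2 v (by simpa using hv)).2.2) ∅ (by simp)
  rw [← h4]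
  refine Eq.trans ?_ (h3.trans ?_)
  · congr 1
    ext a
    simp only [Finset.mem_filter, Finset.mem_univ, true_and]
    refine and_congr_right fun ha => ?_
    have hfix : a.parent w = id w := by
      rw [← ha]
      exact a.parent_root
    constructor
    · intro h
      refine ⟨fun v hv => ?_, by simp⟩
      rw [← liftWalk_eq_liftWalk hfix (by simpa using hv), h]
    · rintro ⟨h, -⟩
      ext v
      by_cases hv : v ∈ w :: l
      · rw [liftWalk_eq_liftWalk hfix hv, h v (by simpa using hv)]
      · rw [liftWalk_of_notMem hv]
  · congr

end Lift

/-! ### The lifted Schrödinger operator -/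

section Operators

variable {V : Type*} [Fintype V] [DecidableEq V] {G : Digraph V} [DecidableRel G.Adj]

theorem eq_or_adj_of_schrodinger_ne_zero {u v : V} (h : schrodinger G u v ≠ 0) :
    u = v ∨ G.Adj u v := by
  by_contra! hno
  exact h (by simp [schrodinger, laplacian, hno.1, hno.2])

theorem sum_schrodinger_mul (hloop : ∀ v, ¬ G.Adj v v) (r : V) (H : V → Poly G) :
    ∑ u, schrodinger G r u * H u = (∑ e : Edge G, if e.1.1 = r then x e * H e.1.2 else 0)
      - (∑ e : Edge G, if e.1.1 = r then x e else 0) * H r + y G r * H r := by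
  have hentry : ∀ u, schrodinger G r u = (∑ e : Edge G, if e.1 = (r, u) then x e else 0)
      - (if r = u then ∑ e : Edge G, (if e.1.1 = r then x e else 0) else 0)
      + if r = u then y G r else 0 := by
    intro u
    have hsum : (∑ e : Edge G, if e.1 = (r, u) then x e else 0)
        = if h : G.Adj r u then x ⟨(r, u), h⟩ else 0 := by
      split_ifs with h
      · rw [Finset.sum_eq_single ⟨(r, u), h⟩]
        · simp
        · intro e _ he
          rw [if_neg fun h' => he (Subtype.ext h')]
        · simp
      · refine Finset.sum_eq_zero fun e _ => if_neg fun h' => h ?_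
        have := e.2
        rwa [h'] at this
    rw [hsum]
    by_cases hru : r = u
    · subst hru
      simp [schrodinger, laplacian, hloop]
    · simp [schrodinger, laplacian, hru]
  simp only [hentry, add_mul, sub_mul, Finset.sum_add_distrib, Finset.sum_sub_distrib,
    ite_mul, zero_mul, Finset.sum_ite_eq, Finset.mem_univ, if_true, Finset.sum_mul]
  congr 2
  rw [Finset.sum_comm]
  refine Finset.sum_congr rfl fun e _ => ?_
  obtain ⟨⟨p, q⟩, hpq⟩ := e
  by_cases hp : p = r
  · simp [hp]
  · simp [hp]

theorem sum_treeSchrodinger_mul (hloop : ∀ v, ¬ G.Adj v v) (a : SpanningTree G)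
    (H : SpanningTree G → Poly G) :
    ∑ c, treeSchrodinger G a c * H c = ∑ u, schrodinger G a.root u * H (treeMove a u) := by
  have hself : treeMove a a.root = a := by
    rw [treeMove, dif_neg (hloop _)]
  have hweight : ∀ c, treeWeight G a c
      = ∑ e : Edge G, if e.1.1 = a.root ∧ c = treeMove a e.1.2 then x e else 0 := by
    intro c
    refine Finset.sum_congr rfl fun e _ => ?_
    simp only [treeEdge_iff hloop]
  have hsum : ∀ H : SpanningTree G → Poly G, ∑ c, treeWeight G a c * H c
      = ∑ e : Edge G, if e.1.1 = a.root then x e * H (treeMove a e.1.2) else 0 := by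
    intro H
    simp only [hweight, Finset.sum_mul]
    rw [Finset.sum_comm]
    refine Finset.sum_congr rfl fun e _ => ?_
    by_cases he : e.1.1 = a.root <;> simp [he]
  have hzero : treeWeight G a a = 0 := by
    rw [hweight]
    refine Finset.sum_eq_zero fun e _ => if_neg ?_
    rintro ⟨he, ha⟩
    have hadj : G.Adj a.root e.1.2 := he ▸ e.2
    have := root_treeMove a hadj
    rw [← ha] at this
    exact hloop _ (this ▸ hadj)
  have hdiag : ∑ c ∈ Finset.univ.erase a, treeWeight G a c
      = ∑ e : Edge G, if e.1.1 = a.root then x e else 0 := by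
    rw [Finset.sum_erase _ hzero]
    simpa using hsum fun _ => 1
  have hentry : ∀ c, treeSchrodinger G a c = treeWeight G a c
      - (if a = c then ∑ e : Edge G, (if e.1.1 = a.root then x e else 0) else 0)
      + if a = c then y G a.root else 0 := by
    intro c
    by_cases hac : a = c
    · subst hac
      simp [treeSchrodinger, treeLaplacian, hdiag, hzero]
    · simp [treeSchrodinger, treeLaplacian, hac]
  rw [sum_schrodinger_mul hloop, hself]
  simp only [hentry, add_mul, sub_mul, Finset.sum_add_distrib, Finset.sum_sub_distrib,
    ite_mul, zero_mul, Finset.sum_ite_eq, Finset.mem_univ, if_true, hsum]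

open Classical in
theorem treeSchrodinger_pow_apply (hloop : ∀ v, ¬ G.Adj v v) (n : ℕ) (a b : SpanningTree G) :
    (treeSchrodinger G ^ n) a b = walkSum (schrodinger G) n a.root (fun l =>
      if liftWalk a.parent l = b.parent ∧ l.getLast? = some b.root then 1 else 0) := by
  induction n generalizing a with
  | zero =>
    have : a = b ↔ a.parent = b.parent ∧ a.root = b.root :=
      ⟨fun h => h ▸ ⟨rfl, rfl⟩, fun h => SpanningTree.ext_parent h.2 h.1⟩
    simp [walkSum, Matrix.one_apply, liftWalk, this]
  | succ n ih =>
    rw [pow_succ', Matrix.mul_apply, sum_treeSchrodinger_mul hloop]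
    refine Finset.sum_congr rfl fun u _ => ?_
    by_cases hu : schrodinger G a.root u = 0
    · simp [hu]
    · rw [ih]
      have hroot : (treeMove a u).root = u ∧
          (treeMove a u).parent = moveRoot a.parent a.root u := by
        rcases eq_or_adj_of_schrodinger_ne_zero hu with rfl | hu
        · rw [treeMove, dif_neg (hloop _)]
          refine ⟨rfl, ?_⟩
          ext v
          by_cases hv : v = a.root
          · simp [moveRoot, hv, a.parent_root]
          · simp [moveRoot, hv]
        · exact ⟨root_treeMove a hu, parent_treeMove a hu⟩
      rw [hroot.1]
      congr 1
      refine walkSum_congr fun l _ => ?_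
      simp [liftWalk, hroot.2]

open Classical in
/-- Both sides sum, over the closed walks of `G` at `w`, the weight of the walk times the number of
forests rooted at the set of its vertices. -/
theorem sum_treeSchrodinger_pow_eq (hloop : ∀ v, ¬ G.Adj v v) (o : LinearOrder V) (n : ℕ) (w : V) :
    ∑ a : SpanningTree G with a.root = w, (treeSchrodinger G ^ n) a a
      = ∑ a : SpanningTree G with a.root = w, walkSum (schrodinger G) n w (fun l =>
        if (∀ v ∈ l, v ∈ psi o a) ∧ l.getLast? = some w then 1 else 0) := by
  have h1 : ∀ a ∈ Finset.univ.filter (fun a : SpanningTree G => a.root = w),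
      (treeSchrodinger G ^ n) a a = walkSum (schrodinger G) n w (fun l =>
      if liftWalk a.parent l = a.parent ∧ l.getLast? = some w then 1 else 0) := by
    intro a ha
    obtain rfl := (Finset.mem_filter.1 ha).2
    exact treeSchrodinger_pow_apply hloop n a a
  rw [Finset.sum_congr rfl h1, ← walkSum_sum, ← walkSum_sum]
  refine walkSum_congr fun l hl => ?_
  by_cases hw : (w :: l).getLast? = some w
  · have hl' : (w :: l).IsChain (fun u v => u = v ∨ G.Adj u v) :=
      hl.imp fun _ _ => eq_or_adj_of_schrodinger_ne_zero
    have h2 := card_closed_lifts hl' hw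
    have h3 := card_subset_psi hloop o (stronglyConnected_of_closed_walk hl' hw)
      (w := w) (by simp)
    simp only [hw, and_true, Finset.sum_boole, Finset.filter_filter]
    rw [h2, ← h3]
    congr 2
    refine Finset.filter_congr fun a _ => and_congr_right fun _ => ?_
    simp [Finset.subset_iff]
  · simp only [hw, and_false, if_false]

open Classical in
/-- The traces of the powers of the lifted Schrödinger operator are those of a block diagonal matrix
with `m W` blocks `L_W`. -/
theorem trace_treeSchrodinger_pow (hloop : ∀ v, ¬ G.Adj v v) (o : LinearOrder V)
    (m : Finset V → ℕ) (hm : ∀ W, StronglyConnected G W → ∀ w ∈ W, mult G o W w = m W) (n : ℕ) :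
    (treeSchrodinger G ^ n).trace
      = ∑ W : Finset V with StronglyConnected G W, m W * (schrodingerOn G W ^ n).trace := by
  set D : Finset V → V → Poly G := fun W w => walkSum (schrodinger G) n w (fun l =>
    if (∀ v ∈ l, v ∈ W) ∧ l.getLast? = some w then 1 else 0) with hD
  have htr : ∀ W, (schrodingerOn G W ^ n).trace = ∑ w ∈ W, D W w := by
    intro W
    rw [← Finset.sum_coe_sort]
    exact Finset.sum_congr rfl fun w _ => submatrix_pow_apply W n w w
  have hfiber : ∀ w, ∑ a : SpanningTree G with a.root = w, D (psi o a) w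
      = ∑ W : Finset V with StronglyConnected G W, mult G o W w * D W w := by
    intro w
    rw [← Finset.sum_fiberwise_of_maps_to (g := psi o)
      (t := Finset.univ.filter fun W => StronglyConnected G W)]
    · refine Finset.sum_congr rfl fun W _ => ?_
      rw [Finset.sum_congr rfl (g := fun _ => D W w)
        fun a ha => by rw [(Finset.mem_filter.1 ha).2], Finset.sum_const, nsmul_eq_mul,
        Finset.filter_filter]
      rfl
    · exact fun a _ => Finset.mem_filter.2 ⟨Finset.mem_univ _, stronglyConnected_psi o a⟩
  calc (treeSchrodinger G ^ n).trace
      = ∑ w, ∑ a : SpanningTree G with a.root = w, (treeSchrodinger G ^ n) a a :=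
        (Finset.sum_fiberwise _ _ _).symm
    _ = ∑ w, ∑ W : Finset V with StronglyConnected G W, mult G o W w * D W w :=
        Finset.sum_congr rfl fun w _ =>
          (sum_treeSchrodinger_pow_eq hloop o n w).trans (hfiber w)
    _ = ∑ W : Finset V with StronglyConnected G W, ∑ w, mult G o W w * D W w := Finset.sum_comm
    _ = _ := by
        refine Finset.sum_congr rfl fun W hW => ?_
        rw [htr, Finset.mul_sum]
        refine (Finset.sum_subset_zero_on_sdiff (Finset.subset_univ W) ?_ fun w hw => ?_).symm
        · intro w hw
          have : mult G o W w = 0 := by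
            refine Finset.card_eq_zero.2 (Finset.filter_eq_empty_iff.2 fun a _ => ?_)
            rintro ⟨rfl, rfl⟩
            exact (Finset.mem_sdiff.1 hw).2 (root_mem_psi o a)
          rw [this, Nat.cast_zero, zero_mul]
        · rw [hm W (Finset.mem_filter.1 hW).2 w hw]

open Classical in
theorem det_treeSchrodinger (hloop : ∀ v, ¬ G.Adj v v) (o : LinearOrder V)
    (m : Finset V → ℕ) (hm : ∀ W, StronglyConnected G W → ∀ w ∈ W, mult G o W w = m W) :
    (treeSchrodinger G).det
      = ∏ W : Finset V with StronglyConnected G W, (schrodingerOn G W).det ^ m W :=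
  det_eq_prod_of_trace_pow _ _ (fun W : Finset V => W) (fun W => schrodingerOn G W) m
    (trace_treeSchrodinger_pow hloop o m hm)

end Operators

end TreeGraph

theorem mainTheorem2 {V : Type*} [Fintype V] [DecidableEq V]
    (G : Digraph V) [DecidableRel G.Adj] (hloop : ∀ v, ¬ G.Adj v v)
    (hG : TreeGraph.StronglyConnected G Finset.univ)
    (W : Finset V) (hW : TreeGraph.StronglyConnected G W) :
    ∃ m : ℕ,
      (∀ o : LinearOrder V, ∀ w ∈ W, TreeGraph.mult G o W w = m) ∧
      Prime (TreeGraph.schrodingerOn G W).det ∧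
      emultiplicity (TreeGraph.schrodingerOn G W).det (TreeGraph.treeSchrodinger G).det = m := by
  classical
  obtain ⟨o⟩ : Nonempty (LinearOrder V) :=
    ⟨LinearOrder.lift' (Fintype.equivFin V) (Fintype.equivFin V).injective⟩
  let m : Finset V → ℕ := fun X => if h : X.Nonempty then TreeGraph.mult G o X h.choose else 0
  have hm : ∀ o' : LinearOrder V, ∀ X, TreeGraph.StronglyConnected G X →
      ∀ w ∈ X, TreeGraph.mult G o' X w = m X := by
    intro o' X hX w hw
    simp only [m, dif_pos hX.1]
    exact TreeGraph.mult_eq_mult hloop hX o' o hw hX.1.choose_spec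
  have hprime := TreeGraph.prime_det_schrodingerOn hloop W hW
  refine ⟨m W, fun o' => hm o' W hW, hprime, ?_⟩
  rw [TreeGraph.det_treeSchrodinger hloop o m (hm o), Finset.emultiplicity_prod hprime,
    Finset.sum_eq_single W]
  · rw [emultiplicity_pow hprime, FiniteMultiplicity.emultiplicity_self, mul_one]
    exact FiniteMultiplicity.of_prime_left hprime hprime.ne_zero
  · intro X hX hXW
    rw [emultiplicity_pow hprime, emultiplicity_eq_zero.2, mul_zero]
    intro hdvd
    have hX' := TreeGraph.prime_det_schrodingerOn hloop X (Finset.mem_filter.1 hX).2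
    have hassoc := hprime.associated_of_dvd hX' hdvd
    exact hXW (Finset.Subset.antisymm (TreeGraph.subset_of_det_schrodingerOn_dvd hassoc.dvd')
      (TreeGraph.subset_of_det_schrodingerOn_dvd hdvd))
  · intro h
    exact absurd (Finset.mem_filter.2 ⟨Finset.mem_univ _, hW⟩) h
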